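/- Let $n\ge 0$, $X=(X_1,\dots,X_n)$, $F_1,\dots,F_n\in\mathbb Q[X,T]$, $I:=(F_1,\dots,F_n)\subset\mathbb Q[X,T]$, and let $J:=\det(\partial F_i/\partial X_j)_{1\le i,j\le n}$ be the Jacobian determinant with respect to the variables $X$. Affine spaces are taken over $\mathbb C$ with the Zariski topology. Let $\mathcal V:=\{(x,t)\in\mathbb A^{n+1}: F_1(x,t)=0,\dots,F_n(x,t)=0\}$, and let $\pi:\mathcal V\to\mathbb A^1$ be the projection $\pi(x,t):=t$. Let $D$ be a natural number such that $\#\pi^{-1}(t)\le D$ for all but finitely many $t\in\mathbb A^1$, and suppose that there is a point $t_0\in\mathbb A^1$ such that the fibre $\pi^{-1}(t_0)$ is a zero-dimensional (in particular nonempty) variety of degree $D$, i.e. consists of exactly $D$ points, and $J(x,t_0)\neq 0$ for every $(x,t_0)\in\pi^{-1}(t_0)$. Let $\mathcal V_{\rm dom}$ be the union of all irreducible components $\mathcal C$ of $\mathcal V$ with $\overline{\pi(\mathcal C)}=\mathbb A^1$. Then: 1. $\mathcal V_{\rm dom}$ is a nonempty equidimensional variety of dimension $1$. 2. $\mathcal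 V_{\rm dom}$ is the union of all irreducible components of $\mathcal V$ having a nonempty intersection with $\pi^{-1}(t_0)$. 3. $\mathcal V_{\rm dom}=V(I:J^\infty)$, the set of common zeros in $\mathbb A^{n+1}$ of the polynomials $f\in\mathbb Q[X,T]$ such that $J^kf\in I$ for some $k\ge 0$. 4. The restriction $\pi|_{\mathcal V_{\rm dom}}:\mathcal V_{\rm dom}\to\mathbb A^1$ is a dominant map of degree $D$. Here degree $D$ means: there is a nonzero polynomial $P\in\mathbb Q[\Lambda_1,\dots,\Lambda_n]$ such that, for every $\lambda\in\mathbb Q^n$ with $P(\lambda)\ne 0$ and $u:=\lambda_1X_1+\cdots+\lambda_nX_n$, the Zariski closure of the image of $\mathcal V_{\rm dom}$ under $(x,t)\mapsto(t,u(x))$ is the zero set in $\mathbb A^2$ of a polynomial in $\mathbb Q[T,Y]$, and such a polynomial $M_u$ of minimal total degree has $\deg_Y M_u=D$. -/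

import Mathlib

open MvPolynomial

noncomputable section

/-! ### Affine varieties over the complex numbers -/

/-- The Zariski topology on the affine space `ℂ^σ`: the closed sets are the zero loci of ideals
of complex polynomials. -/
@[reducible]
def zariskiTop (σ : Type) : TopologicalSpace (σ → ℂ) :=
  TopologicalSpace.ofClosed {V | ∃ I : Ideal (MvPolynomial σ ℂ), V = zeroLocus ℂ I}
    ⟨⊤, by rw [zeroLocus_top]; rfl⟩
    (by
      intro A hA
      refine ⟨vanishingIdeal ℂ (⋂₀ A), Set.Subset.antisymm (zeroLocus_vanishingIdeal_le _) ?_⟩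
      intro x hx V hV
      obtain ⟨I, rfl⟩ := hA hV
      intro p hp
      exact hx p fun y hy => hy _ hV p hp)
    (by
      rintro _ ⟨I, rfl⟩ _ ⟨J, rfl⟩
      refine ⟨I * J, Set.Subset.antisymm ?_ ?_⟩
      · rintro x (hx | hx) p hp
        · exact hx p (Ideal.mul_le_left hp)
        · exact hx p (Ideal.mul_le_right hp)
      · intro x hx
        by_contra h
        simp only [Set.mem_union, not_or, mem_zeroLocus_iff, not_forall] at h
        obtain ⟨⟨p, hp, hpx⟩, q, hq, hqx⟩ := h
        have := hx (p * q) (Ideal.mul_mem_mul hp hq)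
        rw [map_mul] at this
        exact (mul_ne_zero hpx hqx) this)

variable {σ : Type}

/-- An (affine) variety, possibly reducible: a Zariski closed subset of `ℂ^σ`. -/
def IsVariety (V : Set (σ → ℂ)) : Prop := @IsClosed _ (zariskiTop σ) V

/-- The Zariski closure of a subset of `ℂ^σ`. -/
def zariskiClosure (V : Set (σ → ℂ)) : Set (σ → ℂ) := @closure _ (zariskiTop σ) V

/-- The irreducible components of `V ⊆ ℂ^σ`: the maximal irreducible subsets of `V`. -/
def components (V : Set (σ → ℂ)) : Set (Set (σ → ℂ)) :=
  {C | Maximal (fun Z => @IsIrreducible _ (zariskiTop σ) Z ∧ Z ⊆ V) C}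

/-- The dimension of a variety: the Krull dimension of its coordinate ring `ℂ[σ] / I(V)`.
The empty variety has dimension `⊥`. -/
def varietyDim (V : Set (σ → ℂ)) : WithBot ℕ∞ :=
  ringKrullDim (MvPolynomial σ ℂ ⧸ vanishingIdeal ℂ V)

/-- A variety is equidimensional of dimension `d` if all its irreducible components have
dimension `d`. -/
def IsEquidimensional (V : Set (σ → ℂ)) (d : ℕ) : Prop :=
  IsVariety V ∧ ∀ C ∈ components V, varietyDim C = d

/-! ### The projection to the last coordinate

Points of `𝔸^{n+1}` are written `(x, t)`; the variables `X₁, …, Xₙ` are the first `n` ones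
(`Fin.castSucc j`) and `T` is the last one (`Fin.last n`). -/

/-- The projection `(x, t) ↦ t` from `𝔸^{n+1}` to `𝔸¹`. -/
def projT (n : ℕ) (p : Fin (n + 1) → ℂ) : Fin 1 → ℂ := fun _ => p (Fin.last n)

/-- The fibre over `t` of the restriction to `V` of the projection `(x, t) ↦ t`. -/
def fibreT {n : ℕ} (V : Set (Fin (n + 1) → ℂ)) (t : ℂ) : Set (Fin (n + 1) → ℂ) :=
  {p ∈ V | p (Fin.last n) = t}

/-- The restriction to `V` of the projection `(x, t) ↦ t` is dominant. -/
def IsDominantT {n : ℕ} (V : Set (Fin (n + 1) → ℂ)) : Prop :=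
  zariskiClosure (projT n '' V) = Set.univ

/-- `V_dom`: the union of the irreducible components of `V` that project dominantly to `𝔸¹`. -/
def dominantPart {n : ℕ} (V : Set (Fin (n + 1) → ℂ)) : Set (Fin (n + 1) → ℂ) :=
  ⋃₀ {C ∈ components V | IsDominantT C}

/-- For the linear form `u = ∑ lⱼ Xⱼ` with rational coefficients, the map
`(x, t) ↦ (t, u(x))` from `𝔸^{n+1}` to `𝔸²`. -/
def projU {n : ℕ} (l : Fin n → ℚ) (p : Fin (n + 1) → ℂ) : Fin 2 → ℂ :=
  ![p (Fin.last n), ∑ j, (l j : ℂ) * p j.castSucc]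

/-- `M ∈ ℚ[T, Y]` is a polynomial of minimal degree whose zero set is `W ⊆ 𝔸²`
(variable `0` is `T`, variable `1` is `Y`). -/
def IsMinimalEquation (M : MvPolynomial (Fin 2) ℚ) (W : Set (Fin 2 → ℂ)) : Prop :=
  zeroLocus ℂ (Ideal.span {M}) = W ∧
    ∀ M' : MvPolynomial (Fin 2) ℚ, zeroLocus ℂ (Ideal.span {M'}) = W →
      M.totalDegree ≤ M'.totalDegree

/-- The degree of the projection `(x, t) ↦ t` on the curve `V` is `d`: for a generic rational
linear form `u` in `X₁, …, Xₙ` (that is, for all coefficient vectors outside the zero set of some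
nonzero polynomial), the Zariski closure of the image of `V` under `(x, t) ↦ (t, u(x))` is a
hypersurface over `ℚ`, and its equation `M_u ∈ ℚ[T, Y]` of minimal degree, which is unique up to
scaling, has degree `d` in `Y`. -/
def HasProjectionDegree {n : ℕ} (V : Set (Fin (n + 1) → ℂ)) (d : ℕ) : Prop :=
  ∃ P : MvPolynomial (Fin n) ℚ, P ≠ 0 ∧ ∀ l : Fin n → ℚ, eval l P ≠ 0 →
    ∃ M : MvPolynomial (Fin 2) ℚ,
      IsMinimalEquation M (zariskiClosure (projU l '' V)) ∧ M.degreeOf 1 = d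

/-! ### The Jacobian determinant and saturation -/

/-- The Jacobian determinant of `F₁, …, Fₙ ∈ ℚ[X, T]` with respect to `X₁, …, Xₙ`. -/
def jacobianX {n : ℕ} (F : Fin n → MvPolynomial (Fin (n + 1)) ℚ) :
    MvPolynomial (Fin (n + 1)) ℚ :=
  (Matrix.of fun i j : Fin n => pderiv j.castSucc (F i)).det

/-- The saturation `(I : a^∞) = {f | a^k f ∈ I for some k}`. -/
def saturation {R : Type*} [CommRing R] (I : Ideal R) (a : R) : Ideal R where
  carrier := {f | ∃ k : ℕ, a ^ k * f ∈ I}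
  zero_mem' := ⟨0, by simp⟩
  add_mem' := by
    rintro f g ⟨k, hk⟩ ⟨m, hm⟩
    refine ⟨k + m, ?_⟩
    have h : a ^ (k + m) * (f + g) = a ^ m * (a ^ k * f) + a ^ k * (a ^ m * g) := by ring
    rw [h]
    exact I.add_mem (I.mul_mem_left _ hk) (I.mul_mem_left _ hm)
  smul_mem' := by
    rintro c f ⟨k, hk⟩
    refine ⟨k, ?_⟩
    have h : a ^ k * (c • f) = c * (a ^ k * f) := by rw [smul_eq_mul]; ring
    rw [h]
    exact I.mul_mem_left _ hk

end

open Topology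

/-! ### The Zariski topology -/

/-! At a point of `V` with `J ≠ 0` two tools apply. The inverse function theorem for `(F, T)` shows
that nearby fibres contain points of `V` close to the given one
(`eventually_exists_mem_of_jacobianX_ne_zero`). On a component through the point, invertibility of
the Jacobian matrix in the function field `L` kills all differentials over any intermediate field
`K` containing `T`, so `L` is algebraic over `K` (`isAlgebraic_of_jacobianX_ne_zero`). With `K =
ℂ(T)` the component has transcendence degree at most `1`. Were `T` algebraic, `K = ℂ` would make the
component an isolated point of `V`, against the first tool. So the component is a curve dominating
the line.

Conversely, let a dominant component `Z` miss the fibre over `t₀`. For `t` near `t₀` the `D` points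
of that fibre deform to `D` distinct points off `Z`. By Chevalley's theorem `Z` has a point over
almost every `t`, so some fibre has `D + 1` points, which is excluded
(`exists_mem_fibreT_of_isDominantT`). Hence dominant components are exactly those meeting the fibre.

For the saturation, if `g` vanishes on `V_dom`, then `gJ` vanishes on `V`, and the Nullstellensatz
puts a power of `gJ` in `I ⊗ ℂ`. Applying `ℚ`-linear functionals to coefficients brings this back to
`I`. The other inclusion is primality of the ideal of a component.

For the degree, rational relations between `T` and `u` on `V_dom` form a radical ideal saturated
with respect to `ℚ[T]`, hence generated by one primitive `M` that is squarefree over `ℚ(T)`. For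
transcendental `t`, `M(t, Y)` has exactly `deg_Y M` distinct roots. With such a `t` near `t₀`, the
deformed points give `D` distinct roots. Every root lifts to a point of `V_dom` over `t`
(`exists_mem_zeroLocus_of_transcendental`), so the bound on the generic fibre gives at most `D`. -/

theorem isVariety_iff {σ : Type} {V : Set (σ → ℂ)} :
    IsVariety V ↔ ∃ I : Ideal (MvPolynomial σ ℂ), V = zeroLocus ℂ I := by
  change @IsClosed _ (zariskiTop σ) V ↔ _
  rw [← @isOpen_compl_iff _ _ (zariskiTop σ)]
  change Vᶜᶜ ∈ {V | ∃ I : Ideal (MvPolynomial σ ℂ), V = zeroLocus ℂ I} ↔ _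
  rw [compl_compl]; rfl

theorem isVariety_zeroLocus {σ : Type} (I : Ideal (MvPolynomial σ ℂ)) :
    IsVariety (zeroLocus ℂ I) := isVariety_iff.2 ⟨I, rfl⟩

theorem IsVariety.zeroLocus_vanishingIdeal {σ : Type} {V : Set (σ → ℂ)} (hV : IsVariety V) :
    zeroLocus ℂ (vanishingIdeal ℂ V) = V := by
  obtain ⟨I, rfl⟩ := isVariety_iff.1 hV
  exact (zeroLocus_anti_mono (le_vanishingIdeal_zeroLocus I)).antisymm
    (zeroLocus_vanishingIdeal_le _)

theorem isVariety_setOf_aeval {σ ι : Type} {k : Type*} [Field k] [Algebra k ℂ]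
    (F : ι → MvPolynomial σ k) : IsVariety {p : σ → ℂ | ∀ i, aeval p (F i) = 0} := by
  refine isVariety_iff.2 ⟨Ideal.span (Set.range fun i => map (algebraMap k ℂ) (F i)), ?_⟩
  rw [zeroLocus_span]
  ext p
  simp [aeval_def]

theorem zariskiClosure_subset {σ : Type} {U V : Set (σ → ℂ)} (h : U ⊆ V) (hV : IsVariety V) :
    zariskiClosure U ⊆ V := by
  exact @closure_minimal _ (zariskiTop σ) _ _ h hV

theorem zariskiClosure_eq {σ : Type} (V : Set (σ → ℂ)) :
    zariskiClosure V = zeroLocus ℂ (vanishingIdeal ℂ V) := by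
  refine Set.Subset.antisymm
    (zariskiClosure_subset (zeroLocus_vanishingIdeal_le V) (isVariety_zeroLocus _)) ?_
  have h : IsVariety (zariskiClosure V) := @isClosed_closure _ (zariskiTop σ) V
  rw [← h.zeroLocus_vanishingIdeal]
  exact zeroLocus_anti_mono (vanishingIdeal_anti_mono (@subset_closure _ (zariskiTop σ) V))

theorem noetherianSpace_zariskiTop (σ : Type) [Finite σ] :
    @TopologicalSpace.NoetherianSpace _ (zariskiTop σ) := by
  let _ := zariskiTop σ
  refine ((TopologicalSpace.noetherianSpace_TFAE (σ → ℂ)).out 0 1).2 ?_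
  let f : TopologicalSpace.Closeds (σ → ℂ) → (Ideal (MvPolynomial σ ℂ))ᵒᵈ :=
    fun Z => OrderDual.toDual (vanishingIdeal ℂ (Z : Set (σ → ℂ)))
  have hf : StrictMono f := by
    refine Monotone.strictMono_of_injective (fun A B h => vanishingIdeal_anti_mono h) ?_
    intro A B h
    have h' : vanishingIdeal ℂ (A : Set (σ → ℂ)) = vanishingIdeal ℂ (B : Set (σ → ℂ)) := h
    apply TopologicalSpace.Closeds.ext
    rw [← IsVariety.zeroLocus_vanishingIdeal A.isClosed, h',
      IsVariety.zeroLocus_vanishingIdeal B.isClosed]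
  exact hf.wellFoundedLT

theorem isPrime_vanishingIdeal {σ : Type} {Z : Set (σ → ℂ)}
    (hZ : @IsIrreducible _ (zariskiTop σ) Z) : (vanishingIdeal ℂ Z).IsPrime := by
  obtain ⟨x, hx⟩ := @IsIrreducible.nonempty _ (zariskiTop σ) _ hZ
  refine ⟨fun h => ?_, fun {f g} hfg => ?_⟩
  · have : (1 : MvPolynomial σ ℂ) ∈ vanishingIdeal ℂ Z := h ▸ Submodule.mem_top
    simpa using this x hx
  · have h := (@isPreirreducible_iff_isClosed_union_isClosed _ (zariskiTop σ) Z).1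
      (@IsIrreducible.isPreirreducible _ (zariskiTop σ) _ hZ) _ _
      (isVariety_zeroLocus (Ideal.span {f})) (isVariety_zeroLocus (Ideal.span {g}))
      (by
        intro y hy
        have := hfg y hy
        rw [map_mul, mul_eq_zero] at this
        simpa [zeroLocus_span] using this)
    refine h.imp (fun h y hy => ?_) (fun h y hy => ?_) <;>
    simpa [zeroLocus_span] using h hy

theorem exists_subset_of_irreducible_subset_sUnion {σ : Type} {Z : Set (σ → ℂ)}
    (hZ : @IsIrreducible _ (zariskiTop σ) Z) {S : Set (Set (σ → ℂ))} (hS : S.Finite)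
    (hc : ∀ C ∈ S, IsVariety C) (h : Z ⊆ ⋃₀ S) : ∃ C ∈ S, Z ⊆ C := by
  lift S to Finset (Set (σ → ℂ)) using hS
  exact (@isIrreducible_iff_sUnion_isClosed _ (zariskiTop σ) Z).1 hZ S hc h

theorem isVariety_sUnion {σ : Type} {S : Set (Set (σ → ℂ))} (hS : S.Finite)
    (hc : ∀ C ∈ S, IsVariety C) : IsVariety (⋃₀ S) := by
  rw [Set.sUnion_eq_biUnion]
  exact @Set.Finite.isClosed_biUnion _ _ (zariskiTop σ) _ _ hS hc

/-! ### Irreducible components -/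

section Components

variable {σ : Type} {V C : Set (σ → ℂ)}

theorem IsVariety.of_mem_components (hV : IsVariety V) (hC : C ∈ components V) :
    IsVariety C := by
  have h : @closure _ (zariskiTop σ) C ⊆ C := hC.2
    ⟨(@isIrreducible_iff_closure _ (zariskiTop σ) C).2 hC.1.1,
      zariskiClosure_subset hC.1.2 hV⟩ (@subset_closure _ (zariskiTop σ) C)
  exact @isClosed_of_closure_subset _ (zariskiTop σ) _ h

theorem exists_components_superset {Z : Set (σ → ℂ)}
    (hZ : @IsIrreducible _ (zariskiTop σ) Z) (h : Z ⊆ V) : ∃ C ∈ components V, Z ⊆ C := by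
  obtain ⟨C, hZC, hC⟩ := zorn_subset_nonempty
    {Z | @IsIrreducible _ (zariskiTop σ) Z ∧ Z ⊆ V} (fun c hc hcc hne => by
      refine ⟨⋃₀ c, ⟨⟨?_, ?_⟩, ?_⟩, fun s hs => Set.subset_sUnion_of_mem hs⟩
      · obtain ⟨s, hs⟩ := hne
        obtain ⟨x, hx⟩ := @IsIrreducible.nonempty _ (zariskiTop σ) _ (hc hs).1
        exact ⟨x, s, hs, hx⟩
      · intro u v hu hv ⟨y, hy, hyu⟩ ⟨x, hx, hxv⟩
        obtain ⟨p, hpc, hyp⟩ := hy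
        obtain ⟨q, hqc, hxq⟩ := hx
        rcases hcc.total hpc hqc with hpq | hqp
        · obtain ⟨x, hxp, hxuv⟩ := (hc hqc).1.2 u v hu hv ⟨y, hpq hyp, hyu⟩ ⟨x, hxq, hxv⟩
          exact ⟨x, ⟨q, hqc, hxp⟩, hxuv⟩
        · obtain ⟨x, hxp, hxuv⟩ := (hc hpc).1.2 u v hu hv ⟨y, hyp, hyu⟩ ⟨x, hqp hxq, hxv⟩
          exact ⟨x, ⟨p, hpc, hxp⟩, hxuv⟩
      · exact Set.sUnion_subset fun s hs => (hc hs).2) Z ⟨hZ, h⟩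
  exact ⟨C, hC, hZC⟩

theorem exists_mem_components {x : σ → ℂ} (hx : x ∈ V) :
    ∃ C ∈ components V, x ∈ C := by
  obtain ⟨C, hC, h⟩ := exists_components_superset
    (@isIrreducible_singleton _ (zariskiTop σ) x) (Set.singleton_subset_iff.2 hx)
  exact ⟨C, hC, h rfl⟩

theorem finite_components [Finite σ] (hV : IsVariety V) : (components V).Finite := by
  obtain ⟨S, hS, hSc, hSi, hVS⟩ :=
    @TopologicalSpace.NoetherianSpace.exists_finite_set_isClosed_irreducible _ (zariskiTop σ)
      (noetherianSpace_zariskiTop σ) V hV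
  refine hS.subset fun C hC => ?_
  obtain ⟨Z, hZ, hCZ⟩ := exists_subset_of_irreducible_subset_sUnion hC.1.1 hS hSc
    (hC.1.2.trans hVS.subset)
  have : Z ⊆ C := hC.2 ⟨hSi Z hZ, hVS ▸ Set.subset_sUnion_of_mem hZ⟩ hCZ
  rwa [hCZ.antisymm this]

/-- The components of a union of components of `V` are among these components. -/
theorem mem_of_mem_components_sUnion [Finite σ] (hV : IsVariety V) {S : Set (Set (σ → ℂ))}
    (hS : S ⊆ components V) (hC : C ∈ components (⋃₀ S)) : C ∈ S := by
  obtain ⟨Z, hZ, hCZ⟩ := exists_subset_of_irreducible_subset_sUnion hC.1.1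
    ((finite_components hV).subset hS) (fun Z hZ => hV.of_mem_components (hS hZ)) hC.1.2
  have : Z ⊆ C := hC.2 ⟨(hS hZ).1.1, Set.subset_sUnion_of_mem hZ⟩ hCZ
  rwa [hCZ.antisymm this]

end Components

/-! ### Comparison with the classical topology -/

theorem continuous_aeval_mvPolynomial {σ k : Type*} [Field k] [Algebra k ℂ]
    (f : MvPolynomial σ k) : Continuous fun p : σ → ℂ => aeval p f := by
  induction f using MvPolynomial.induction_on with
  | C a => simpa using continuous_const
  | add p q hp hq => simp only [map_add]; exact hp.add hq
  | mul_X p i hp => simp only [map_mul, aeval_X]; exact hp.mul (continuous_apply i)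

theorem IsVariety.isClosed {σ : Type} {V : Set (σ → ℂ)} (hV : IsVariety V) : IsClosed V := by
  rw [← hV.zeroLocus_vanishingIdeal]
  have : zeroLocus ℂ (vanishingIdeal ℂ V) = ⋂ f ∈ vanishingIdeal ℂ V,
      {p : σ → ℂ | aeval p f = 0} := by
    ext p; simp
  rw [this]
  exact isClosed_biInter fun f _ =>
    isClosed_eq (continuous_aeval_mvPolynomial f) continuous_const

/-! ### The implicit function theorem at the points where the Jacobian does not vanish -/

theorem hasStrictFDerivAt_aeval {σ : Type*} [Fintype σ] {k : Type*} [Field k] [Algebra k ℂ]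
    (f : MvPolynomial σ k) (p : σ → ℂ) :
    HasStrictFDerivAt (𝕜 := ℂ) (fun q : σ → ℂ => aeval q f)
      (∑ i, aeval p (pderiv i f) • (ContinuousLinearMap.proj i : (σ → ℂ) →L[ℂ] ℂ)) p := by
  classical
  induction f using MvPolynomial.induction_on with
  | C a => 
    simp only [aeval_C]
    refine (hasStrictFDerivAt_const (𝕜 := ℂ) (algebraMap k ℂ a) p).congr_fderiv ?_
    ext v
    simp
  | add f g hf hg =>
    simp only [map_add]
    refine (hf.add hg).congr_fderiv ?_
    ext v
    simp [add_mul, Finset.sum_add_distrib]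
  | mul_X f i hf =>
    simp only [map_mul, aeval_X]
    refine (hf.mul (ContinuousLinearMap.proj i : (σ → ℂ) →L[ℂ] ℂ).hasStrictFDerivAt).congr_fderiv ?_
    ext v
    simp only [add_apply, smul_apply,
      sum_apply, ContinuousLinearMap.proj_apply, smul_eq_mul,
      Derivation.leibniz, pderiv_X, map_add, map_mul, aeval_X, add_mul, Finset.sum_add_distrib,
      Finset.mul_sum]
    congr 1
    · rw [Finset.sum_eq_single i]
      · simp
      · intro b _ hb
        simp [hb.symm]
      · simp
    · exact Finset.sum_congr rfl fun j _ => by ring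

theorem eventually_exists_mem_of_jacobianX_ne_zero {n : ℕ}
    (F : Fin n → MvPolynomial (Fin (n + 1)) ℚ) {p : Fin (n + 1) → ℂ}
    (hp : ∀ i, aeval p (F i) = 0) (hJ : aeval p (jacobianX F) ≠ 0)
    {U : Set (Fin (n + 1) → ℂ)} (hU : U ∈ 𝓝 p) :
    ∀ᶠ t in 𝓝 (p (Fin.last n)), ∃ q ∈ U, (∀ i, aeval q (F i) = 0) ∧ q (Fin.last n) = t := by
  let G : (Fin (n + 1) → ℂ) → (Fin n → ℂ) × ℂ := fun q => (fun i => aeval q (F i), q (Fin.last n))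
  let G' : (Fin (n + 1) → ℂ) →L[ℂ] (Fin n → ℂ) × ℂ :=
    (ContinuousLinearMap.pi fun i => ∑ j, aeval p (pderiv j (F i)) •
      ContinuousLinearMap.proj (R := ℂ) (φ := fun _ : Fin (n + 1) => ℂ) j).prod
      (ContinuousLinearMap.proj (R := ℂ) (φ := fun _ : Fin (n + 1) => ℂ) (Fin.last n))
  have hG : HasStrictFDerivAt G G' p :=
    (hasStrictFDerivAt_pi.2 fun i => hasStrictFDerivAt_aeval (F i) p).prodMk
      (ContinuousLinearMap.proj (R := ℂ) (φ := fun _ : Fin (n + 1) => ℂ)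
        (Fin.last n)).hasStrictFDerivAt
  -- The last row of the derivative forces `v_T = 0`; what remains is the Jacobian matrix in the
  -- `X`-variables, which is invertible.
  have hinj : Function.Injective G'.toLinearMap := by
    rw [← LinearMap.ker_eq_bot, LinearMap.ker_eq_bot']
    intro v hv
    have h2 : v (Fin.last n) = 0 := congrArg Prod.snd hv
    have h1 : ∀ i, ∑ j : Fin n, aeval p (pderiv j.castSucc (F i)) * v j.castSucc = 0 := by
      intro i
      have := congrFun (congrArg Prod.fst hv) i
      simpa [G', Fin.sum_univ_castSucc, h2] using this
    let A : Matrix (Fin n) (Fin n) ℂ := Matrix.of fun i j => aeval p (pderiv j.castSucc (F i))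
    have hA : A.det ≠ 0 := by
      have : aeval p (jacobianX F) = A.det := by
        rw [jacobianX, AlgHom.map_det]; rfl
      rwa [← this]
    have h3 : (fun j : Fin n => v j.castSucc) = 0 :=
      Matrix.eq_zero_of_mulVec_eq_zero hA (funext h1)
    ext j
    induction j using Fin.lastCases with
    | last => exact h2
    | cast j => exact congrFun h3 j
  have hsurj : G'.range = ⊤ := by
    refine LinearMap.range_eq_top.2 ?_
    exact (LinearMap.injective_iff_surjective_of_finrank_eq_finrank (by simp)).1 hinj
  have hm := hG.map_nhds_eq_of_surj hsurj
  have h4 : G '' U ∈ 𝓝 (G p) := hm ▸ Filter.image_mem_map hU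
  have h5 : Filter.Tendsto (fun t : ℂ => ((0 : Fin n → ℂ), t)) (𝓝 (p (Fin.last n))) (𝓝 (G p)) := by
    have : G p = ((0 : Fin n → ℂ), p (Fin.last n)) := by
      ext i
      · exact hp i
      · rfl
    rw [this]
    exact (Continuous.prodMk_right (0 : Fin n → ℂ)).tendsto _
  filter_upwards [h5 h4] with t ht
  obtain ⟨q, hq, hqt⟩ := ht
  exact ⟨q, hq, fun i => congrFun (congrArg Prod.fst hqt) i, congrArg Prod.snd hqt⟩

/-! ### Function fields of the components on which the Jacobian does not vanish -/

theorem derivation_aeval {K L M : Type*} [Field K] [Field L] [CharZero K] [CharZero L]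
    [Algebra K L]
    [AddCommGroup M] [Module K M] [Module L M] (D : Derivation K L M) {σ : Type*} [Fintype σ]
    (x : σ → L) (f : MvPolynomial σ ℚ) :
    D (aeval x f) = ∑ i, aeval x (pderiv i f) • D (x i) := by
  classical
  induction f using MvPolynomial.induction_on with
  | C a =>
    have : algebraMap ℚ L a = algebraMap K L (a : K) := by simp
    rw [aeval_C, this, Derivation.map_algebraMap]
    simp
  | add f g hf hg => simp [hf, hg, add_smul, Finset.sum_add_distrib]
  | mul_X f i hf =>
    simp only [map_mul, aeval_X, Derivation.leibniz, hf, pderiv_X, smul_eq_mul, map_add,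
      add_smul, Finset.sum_add_distrib, Finset.smul_sum]
    congr 1
    · rw [Finset.sum_eq_single i]
      · simp
      · intro b _ hb
        simp [hb.symm]
      · simp
    · exact Finset.sum_congr rfl fun j _ => by rw [smul_smul]

/-- Differentiating `F i = 0` over `K`, where `dT = 0`, gives a linear system for the `dXⱼ` with
invertible matrix. So `Ω[L⁄K] = 0`, and an essentially finitely generated unramified field extension
is separable algebraic. -/
theorem isAlgebraic_of_jacobianX_ne_zero {K L : Type} [Field K] [Field L] [CharZero K]
    [CharZero L] [Algebra K L] [Algebra.EssFiniteType K L] {n : ℕ}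
    (F : Fin n → MvPolynomial (Fin (n + 1)) ℚ) (x : Fin (n + 1) → L)
    (h0 : ∀ i, aeval x (F i) = 0) (hJ : aeval x (jacobianX F) ≠ 0)
    (hlast : x (Fin.last n) ∈ Set.range (algebraMap K L))
    (hgen : IntermediateField.adjoin K (Set.range x) = ⊤) : Algebra.IsAlgebraic K L := by
  have hx : ∀ j, KaehlerDifferential.D K L (x j) = 0 := by
    have hl : KaehlerDifferential.D K L (x (Fin.last n)) = 0 := by
      obtain ⟨a, ha⟩ := hlast
      rw [← ha, Derivation.map_algebraMap]
    let A : Matrix (Fin n) (Fin n) L := Matrix.of fun i j => aeval x (pderiv j.castSucc (F i))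
    have hA : IsUnit A.det := by
      have : aeval x (jacobianX F) = A.det := by rw [jacobianX, AlgHom.map_det]; rfl
      exact (this ▸ hJ).isUnit
    have h1 : ∀ i, ∑ j : Fin n, A i j • KaehlerDifferential.D K L (x j.castSucc) = 0 := by
      intro i
      have h := derivation_aeval (KaehlerDifferential.D K L) x (F i)
      rw [h0, map_zero, Fin.sum_univ_castSucc, hl, smul_zero, add_zero] at h
      exact h.symm
    have h2 : ∀ j : Fin n, KaehlerDifferential.D K L (x j.castSucc) = 0 := by
      intro j
      calc KaehlerDifferential.D K L (x j.castSucc)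
          = ∑ k, (A⁻¹ * A) j k • KaehlerDifferential.D K L (x k.castSucc) := by
            rw [Matrix.nonsing_inv_mul _ hA]
            simp [Matrix.one_apply, ite_smul]
        _ = ∑ i, A⁻¹ j i • ∑ k, A i k • KaehlerDifferential.D K L (x k.castSucc) := by
            simp only [Matrix.mul_apply, Finset.sum_smul, Finset.smul_sum, smul_smul]
            exact Finset.sum_comm
        _ = 0 := by simp [h1]
    intro j
    induction j using Fin.lastCases with
    | last => exact hl
    | cast j => exact h2 j
  have hD : ∀ a : L, KaehlerDifferential.D K L a = 0 := by
    intro a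
    have ha : a ∈ IntermediateField.adjoin K (Set.range x) := hgen ▸ IntermediateField.mem_top
    induction ha using IntermediateField.adjoin_induction with
    | mem a ha =>
      obtain ⟨j, rfl⟩ := ha
      exact hx j
    | algebraMap a => exact Derivation.map_algebraMap _ a
    | add a b _ _ ha hb => rw [map_add, ha, hb, add_zero]
    | inv a _ ha => rw [Derivation.leibniz_inv, ha, smul_zero]
    | mul a b _ _ ha hb => rw [Derivation.leibniz, ha, hb, smul_zero, smul_zero, add_zero]
  have hs : Subsingleton (Ω[L⁄K]) := by
    rw [← Submodule.subsingleton_iff L, ← subsingleton_iff_bot_eq_top,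
      ← KaehlerDifferential.span_range_derivation K L, eq_comm, Submodule.span_eq_bot]
    rintro _ ⟨a, rfl⟩
    exact hD a
  have : Algebra.FormallyUnramified K L := ⟨hs⟩
  have := Algebra.FormallyUnramified.isSeparable K L
  infer_instance

open scoped IntermediateField.algebraAdjoinAdjoin in
theorem trdeg_le_one_of_isAlgebraic_adjoin_simple {K L : Type*} [Field K] [Field L] [Algebra K L]
    (τ : L) [Algebra.IsAlgebraic (IntermediateField.adjoin K {τ}) L] :
    Algebra.trdeg K L ≤ 1 := by
  have : Algebra.IsAlgebraic (Algebra.adjoin K {τ}) L :=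
    (IsFractionRing.comap_isAlgebraic_iff (K := IntermediateField.adjoin K {τ})).2 inferInstance
  have h := Algebra.IsAlgebraic.trdeg_le_cardinalMk K ({τ} : Set L)
  rwa [Cardinal.mk_singleton] at h

section Quotient

variable {n : ℕ} {F : Fin n → MvPolynomial (Fin (n + 1)) ℚ}
  {p : Ideal (MvPolynomial (Fin (n + 1)) ℂ)} [p.IsPrime]

/-- The intermediate field `K` is left free because it is needed both as `ℂ(T)` and, when `T` is
algebraic, as `ℂ` itself. -/
theorem isAlgebraic_fractionRing_quotient (hF : ∀ i, map (algebraMap ℚ ℂ) (F i) ∈ p)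
    (hJ : map (algebraMap ℚ ℂ) (jacobianX F) ∉ p)
    (K : Type) [Field K] [Algebra ℂ K] [Algebra K (FractionRing (MvPolynomial (Fin (n + 1)) ℂ ⧸ p))]
    [IsScalarTower ℂ K (FractionRing (MvPolynomial (Fin (n + 1)) ℂ ⧸ p))]
    (hK : algebraMap (MvPolynomial (Fin (n + 1)) ℂ ⧸ p)
        (FractionRing (MvPolynomial (Fin (n + 1)) ℂ ⧸ p))
      (Ideal.Quotient.mk p (X (Fin.last n))) ∈ Set.range (algebraMap K _)) :
    Algebra.IsAlgebraic K (FractionRing (MvPolynomial (Fin (n + 1)) ℂ ⧸ p)) := by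
  set A := MvPolynomial (Fin (n + 1)) ℂ ⧸ p
  set L := FractionRing A
  have : Algebra.EssFiniteType A L := .of_isLocalization _ (nonZeroDivisors A)
  have : Algebra.EssFiniteType ℂ L := .comp ℂ A L
  have : CharZero K := charZero_of_injective_algebraMap (algebraMap ℂ K).injective
  have : CharZero L := charZero_of_injective_algebraMap (algebraMap ℂ L).injective
  have : Algebra.EssFiniteType K L := .of_comp ℂ K L
  let x : Fin (n + 1) → L := fun j => algebraMap A L (Ideal.Quotient.mk p (X j))
  have hx : ∀ f : MvPolynomial (Fin (n + 1)) ℂ,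
      aeval x f = algebraMap A L (Ideal.Quotient.mk p f) := by
    intro f
    have : aeval x = (IsScalarTower.toAlgHom ℂ A L).comp (Ideal.Quotient.mkₐ ℂ p) := by
      ext j
      simp only [aeval_X, x]; rfl
    rw [this]; rfl
  have hx' : ∀ f : MvPolynomial (Fin (n + 1)) ℚ,
      aeval x f = algebraMap A L (Ideal.Quotient.mk p (map (algebraMap ℚ ℂ) f)) := by
    intro f
    rw [← hx, aeval_map_algebraMap]
  refine isAlgebraic_of_jacobianX_ne_zero F x (fun i => ?_) ?_ hK ?_
  · rw [hx', Ideal.Quotient.eq_zero_iff_mem.2 (hF i), map_zero]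
  · rw [hx', Ne, FaithfulSMul.algebraMap_eq_zero_iff, Ideal.Quotient.eq_zero_iff_mem]
    exact hJ
  · have hA : ∀ a : A, algebraMap A L a ∈ IntermediateField.adjoin K (Set.range x) := by
      intro a
      obtain ⟨f, rfl⟩ := Ideal.Quotient.mk_surjective a
      rw [← hx]
      induction f using MvPolynomial.induction_on with
      | C c =>
        rw [aeval_C, IsScalarTower.algebraMap_apply ℂ K L]
        exact IntermediateField.algebraMap_mem _ _
      | add f g hf hg => rw [map_add]; exact add_mem hf hg
      | mul_X f i hf =>
        rw [map_mul, aeval_X]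
        exact mul_mem hf (IntermediateField.subset_adjoin _ _ ⟨i, rfl⟩)
    refine eq_top_iff.2 fun a _ => ?_
    obtain ⟨b, c, _, rfl⟩ := IsFractionRing.div_surjective (A := A) a
    exact div_mem (hA b) (hA c)

theorem trdeg_quotient_le_one (hF : ∀ i, map (algebraMap ℚ ℂ) (F i) ∈ p)
    (hJ : map (algebraMap ℚ ℂ) (jacobianX F) ∉ p) :
    Algebra.trdeg ℂ (MvPolynomial (Fin (n + 1)) ℂ ⧸ p) ≤ 1 := by
  set A := MvPolynomial (Fin (n + 1)) ℂ ⧸ p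
  set L := FractionRing A
  let τ : L := algebraMap A L (Ideal.Quotient.mk p (X (Fin.last n)))
  have := isAlgebraic_fractionRing_quotient hF hJ (IntermediateField.adjoin ℂ {τ})
    ⟨⟨τ, IntermediateField.mem_adjoin_simple_self ℂ τ⟩, rfl⟩
  have h := trdeg_le_one_of_isAlgebraic_adjoin_simple (K := ℂ) τ
  exact (trdeg_le_of_injective (IsScalarTower.toAlgHom ℂ A L)
    (IsFractionRing.injective A L)).trans h

/-- As `ℂ` is algebraically closed, an algebraic `T` is a constant; then the whole function field is
algebraic over `ℂ`, hence equal to it, and every coordinate is constant. -/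
theorem exists_X_sub_C_mem (hF : ∀ i, map (algebraMap ℚ ℂ) (F i) ∈ p)
    (hJ : map (algebraMap ℚ ℂ) (jacobianX F) ∉ p)
    (ht : IsAlgebraic ℂ (Ideal.Quotient.mk p (X (Fin.last n)))) :
    ∃ x : Fin (n + 1) → ℂ, ∀ j, X j - C (x j) ∈ p := by
  set A := MvPolynomial (Fin (n + 1)) ℂ ⧸ p
  set L := FractionRing A
  have hbot : algebraMap A L (Ideal.Quotient.mk p (X (Fin.last n))) ∈
      Set.range (algebraMap ℂ L) := by
    set a := algebraMap A L (Ideal.Quotient.mk p (X (Fin.last n)))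
    have ha : IsIntegral ℂ a :=
      (isAlgebraic_iff_isIntegral.1 ht).map (IsScalarTower.toAlgHom ℂ A L)
    have : Algebra.IsAlgebraic ℂ (IntermediateField.adjoin ℂ {a}) :=
      IntermediateField.isAlgebraic_adjoin_simple ha
    have h := IntermediateField.mem_adjoin_simple_self ℂ a
    rwa [IntermediateField.eq_bot_of_isAlgClosed_of_isAlgebraic (IntermediateField.adjoin ℂ {a}),
      IntermediateField.mem_bot] at h
  have := isAlgebraic_fractionRing_quotient hF hJ ℂ hbot
  have hs : Function.Surjective (algebraMap ℂ L) :=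
    (IsAlgClosed.algebraMap_bijective_of_isIntegral (k := ℂ) (K := L)).2
  choose x hx using fun j => hs (algebraMap A L (Ideal.Quotient.mk p (X j)))
  refine ⟨x, fun j => ?_⟩
  rw [← Ideal.Quotient.eq_zero_iff_mem, ← FaithfulSMul.algebraMap_eq_zero_iff A L, map_sub,
    map_sub, ← hx j, sub_eq_zero]
  rfl

/-- Noether normalization makes `A` integral over a polynomial ring in `s` variables. The
transcendence degree gives `s ≤ 1`, the transcendence of `T` gives `s ≠ 0`, and dimension is
compared along the integral extension. -/
theorem krullDim_quotient_eq_one (hF : ∀ i, map (algebraMap ℚ ℂ) (F i) ∈ p)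
    (hJ : map (algebraMap ℚ ℂ) (jacobianX F) ∉ p)
    (ht : Transcendental ℂ (Ideal.Quotient.mk p (X (Fin.last n)))) :
    ringKrullDim (MvPolynomial (Fin (n + 1)) ℂ ⧸ p) = 1 := by
  have htr := trdeg_quotient_le_one hF hJ
  set A := MvPolynomial (Fin (n + 1)) ℂ ⧸ p
  obtain ⟨s, g, hg, hgi⟩ := exists_integral_inj_algHom_of_fg ℂ A
  have hs1 : s ≤ 1 := by
    have := (trdeg_le_of_injective g hg).trans htr
    rw [MvPolynomial.trdeg_of_isDomain] at this
    simpa using this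
  algebraize [g.toRingHom]
  have : IsScalarTower ℂ (MvPolynomial (Fin s) ℂ) A := .of_algebraMap_eq' g.comp_algebraMap.symm
  have hinj : Function.Injective (algebraMap (MvPolynomial (Fin s) ℂ) A) := hg
  have : FaithfulSMul (MvPolynomial (Fin s) ℂ) A := (faithfulSMul_iff_algebraMap_injective _ _).2 hinj
  have : Algebra.IsIntegral (MvPolynomial (Fin s) ℂ) A := ⟨hgi⟩
  have hs : s = 1 := by
    refine le_antisymm hs1 (Nat.one_le_iff_ne_zero.2 ?_)
    rintro rfl
    apply ht
    have : Algebra.IsIntegral ℂ (MvPolynomial (Fin 0) ℂ) := by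
      refine ⟨fun f => ?_⟩
      rw [MvPolynomial.eq_C_of_isEmpty f]
      exact isIntegral_algebraMap
    have := Algebra.IsIntegral.trans (R := ℂ) (A := MvPolynomial (Fin 0) ℂ) (B := A)
    exact (Algebra.IsIntegral.isIntegral _).isAlgebraic
  subst hs
  have e : MvPolynomial (Fin 1) ℂ ≃+* Polynomial ℂ := (MvPolynomial.uniqueAlgEquiv ℂ (Fin 1)).toRingEquiv
  have hd : Ring.KrullDimLE 1 (MvPolynomial (Fin 1) ℂ) := by
    rw [Ring.krullDimLE_iff]
    rw [ringKrullDim_eq_of_ringEquiv e]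
    exact Ring.krullDimLE_iff.1 inferInstance
  have hA : Ring.KrullDimLE 1 A := by
    refine Ring.KrullDimLE.mk₁' fun P hP hPp => ?_
    have hc : (P.comap (algebraMap (MvPolynomial (Fin 1) ℂ) A)) ≠ ⊥ :=
      fun h => hP (Ideal.eq_bot_of_comap_eq_bot h)
    have := (hPp.comap (algebraMap (MvPolynomial (Fin 1) ℂ) A)).isMaximal_of_ne_bot hc
    exact Ideal.isMaximal_of_isIntegral_of_isMaximal_comap P this
  refine le_antisymm (Ring.krullDimLE_iff.1 hA) ?_
  by_contra h
  -- A domain of dimension `0` is a field, and integrality would then make the polynomial ring in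
  -- one variable a field.
  have h0 : Ring.KrullDimLE 0 A := by
    rw [Ring.krullDimLE_iff]
    exact ENat.WithBot.lt_add_one_iff.1 (by simpa using h)
  have hf : IsField A := Ring.KrullDimLE.isField_of_isDomain
  have := isField_of_isIntegral_of_isField hinj hf
  exact Polynomial.not_isField ℂ (e.symm.isField this)

end Quotient

/-! ### Components that dominate the line -/

/-- An irreducible variety on which `T` is transcendental meets almost all the fibres. -/
theorem eventually_exists_mem_zeroLocus {n : ℕ} {p : Ideal (MvPolynomial (Fin (n + 1)) ℂ)}
    [p.IsPrime] (ht : Transcendental ℂ (Ideal.Quotient.mk p (X (Fin.last n)))) :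
    ∀ᶠ t : ℂ in Filter.cofinite, ∃ x ∈ zeroLocus ℂ p, x (Fin.last n) = t := by
  set A := MvPolynomial (Fin (n + 1)) ℂ ⧸ p
  let f : Polynomial ℂ →ₐ[ℂ] A := Polynomial.aeval (Ideal.Quotient.mk p (X (Fin.last n)))
  have hf : Function.Injective f := transcendental_iff_injective.1 ht
  have hfp : (f : Polynomial ℂ →+* A).FinitePresentation := by
    rw [← RingHom.FinitePresentation.of_finiteType]
    refine RingHom.FiniteType.of_comp_finiteType (f := algebraMap ℂ (Polynomial ℂ)) ?_
    have : (f : Polynomial ℂ →+* A).comp (algebraMap ℂ (Polynomial ℂ)) = algebraMap ℂ A :=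
      f.comp_algebraMap
    rw [this, RingHom.finiteType_algebraMap]
    infer_instance
  -- Chevalley: the image of `Spec A` in `Spec ℂ[T]` is constructible. It contains the generic
  -- point, so some piece has all its closed conditions `B.g i` zero and `B.f ≠ 0`; this piece
  -- contains every closed point outside the finitely many roots of `B.f`.
  obtain ⟨S, hS⟩ := PrimeSpectrum.exists_constructibleSetData_iff.2
    (PrimeSpectrum.isConstructible_range_comap hfp)
  have hbot : (⊥ : PrimeSpectrum (Polynomial ℂ)) ∈ S.toSet := by
    rw [hS]
    refine ⟨⟨⊥, Ideal.isPrime_bot⟩, PrimeSpectrum.ext ?_⟩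
    exact Ideal.comap_bot_of_injective _ hf
  rw [PrimeSpectrum.ConstructibleSetData.toSet] at hbot
  simp only [Set.mem_iUnion] at hbot
  obtain ⟨B, hBS, hB⟩ := hbot
  have hBf : B.f ≠ 0 := by
    have := hB.2
    simpa [PrimeSpectrum.mem_zeroLocus] using this
  have hBg : ∀ i, B.g i = 0 := by
    intro i
    have : B.g i ∈ (⊥ : PrimeSpectrum (Polynomial ℂ)).asIdeal := hB.1 ⟨i, rfl⟩
    simpa using this
  have hfin : {c : ℂ | B.f.eval c = 0}.Finite := Polynomial.finite_setOfPred_isRoot hBf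
  filter_upwards [hfin.compl_mem_cofinite] with c hc
  let P : PrimeSpectrum (Polynomial ℂ) :=
    ⟨Ideal.span {Polynomial.X - Polynomial.C c},
      (Ideal.span_singleton_prime (Polynomial.X_sub_C_ne_zero c)).2 (Polynomial.prime_X_sub_C c)⟩
  have hP : P ∈ S.toSet := by
    rw [PrimeSpectrum.ConstructibleSetData.toSet]
    simp only [Set.mem_iUnion]
    refine ⟨B, hBS, ?_, ?_⟩
    · rintro _ ⟨i, rfl⟩
      rw [hBg]; exact zero_mem _
    · intro h
      have : B.f ∈ Ideal.span {Polynomial.X - Polynomial.C c} := h rfl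
      rw [Ideal.mem_span_singleton, Polynomial.dvd_iff_isRoot] at this
      exact hc this
  rw [hS] at hP
  obtain ⟨Q, hQ⟩ := hP
  -- The prime over `T - c` need not be maximal; a maximal ideal above it still contains `T - c`,
  -- and the Nullstellensatz turns it into a point.
  obtain ⟨M, hM, hQM⟩ := Ideal.exists_le_maximal (Q.asIdeal.comap (Ideal.Quotient.mk p))
    (Ideal.IsPrime.ne_top inferInstance)
  obtain ⟨x, rfl⟩ := eq_vanishingIdeal_singleton_of_isMaximal ℂ hM
  refine ⟨x, fun g hg => hQM ?_ x rfl, ?_⟩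
  · rw [Ideal.mem_comap, Ideal.Quotient.eq_zero_iff_mem.2 hg]; exact zero_mem _
  · have h1 : Polynomial.X - Polynomial.C c ∈ P.asIdeal := Ideal.subset_span rfl
    rw [← hQ] at h1
    have h2 : X (Fin.last n) - C c ∈ Q.asIdeal.comap (Ideal.Quotient.mk p) := by
      have : f (Polynomial.X - Polynomial.C c) ∈ Q.asIdeal := h1
      rw [Ideal.mem_comap]
      convert! this using 1
      simp [f]; rfl
    have := hQM h2 x rfl
    simpa [sub_eq_zero] using this

/-- Both sides say that no nonzero polynomial in one variable vanishes on the projection of `Z`. -/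
theorem isDominantT_iff_transcendental {n : ℕ} (Z : Set (Fin (n + 1) → ℂ)) :
    IsDominantT Z ↔
      Transcendental ℂ (Ideal.Quotient.mk (vanishingIdeal ℂ Z) (X (Fin.last n))) := by
  have key : ∀ f : MvPolynomial (Fin 1) ℂ,
      aeval (fun _ : Fin 1 => Ideal.Quotient.mk (vanishingIdeal ℂ Z) (X (Fin.last n))) f = 0 ↔
      f ∈ vanishingIdeal ℂ (projT n '' Z) := by
    intro f
    have h1 : aeval (fun _ : Fin 1 => Ideal.Quotient.mk (vanishingIdeal ℂ Z) (X (Fin.last n))) f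
        = Ideal.Quotient.mk (vanishingIdeal ℂ Z) (rename (fun _ => Fin.last n) f) := by
      have : aeval (fun _ : Fin 1 => Ideal.Quotient.mk (vanishingIdeal ℂ Z) (X (Fin.last n)))
          = (Ideal.Quotient.mkₐ ℂ (vanishingIdeal ℂ Z)).comp (rename fun _ => Fin.last n) := by
        ext i
        simp only [aeval_X, AlgHom.comp_apply, rename_X]; rfl
      rw [this]; rfl
    rw [h1, Ideal.Quotient.eq_zero_iff_mem, mem_vanishingIdeal_iff, mem_vanishingIdeal_iff,
      Set.forall_mem_image]
    refine forall₂_congr fun x _ => ?_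
    rw [aeval_rename]; rfl
  rw [← algebraicIndependent_unique_type_iff (ι := Fin 1)
    (x := fun _ : Fin 1 => Ideal.Quotient.mk (vanishingIdeal ℂ Z) (X (Fin.last n))),
    algebraicIndependent_iff, IsDominantT, zariskiClosure_eq]
  constructor
  · intro h f hf
    refine MvPolynomial.funext fun x => ?_
    have hx : x ∈ zeroLocus ℂ (vanishingIdeal ℂ (projT n '' Z)) := h ▸ Set.mem_univ x
    simpa [aeval_eq_eval] using hx f ((key f).1 hf)
  · intro h
    refine Set.eq_univ_of_forall fun x f hf => ?_
    rw [h f ((key f).2 hf), map_zero]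

/-! ### The dominant part and the fibre over `t₀` -/

section DominantPart

variable {n : ℕ} {F : Fin n → MvPolynomial (Fin (n + 1)) ℚ} {Z : Set (Fin (n + 1) → ℂ)}

theorem map_mem_vanishingIdeal_iff {σ : Type} {Z : Set (σ → ℂ)} (f : MvPolynomial σ ℚ) :
    map (algebraMap ℚ ℂ) f ∈ vanishingIdeal ℂ Z ↔ ∀ x ∈ Z, aeval x f = 0 := by
  simp only [mem_vanishingIdeal_iff, aeval_map_algebraMap]

theorem isDominantT_of_jacobianX_ne_zero (hZ : Z ∈ components {p | ∀ i, aeval p (F i) = 0})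
    {x : Fin (n + 1) → ℂ} (hx : x ∈ Z) (hJ : aeval x (jacobianX F) ≠ 0) : IsDominantT Z := by
  set V := {p : Fin (n + 1) → ℂ | ∀ i, aeval p (F i) = 0}
  have hV : IsVariety V := isVariety_setOf_aeval F
  have hp := isPrime_vanishingIdeal hZ.1.1
  rw [isDominantT_iff_transcendental]
  intro halg
  obtain ⟨c, hc⟩ := exists_X_sub_C_mem (F := F)
    (fun i => (map_mem_vanishingIdeal_iff _).2 fun y hy => hZ.1.2 hy i)
    (fun h => hJ ((map_mem_vanishingIdeal_iff _).1 h x hx)) halg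
  have hZc : ∀ y ∈ Z, y = c := by
    intro y hy
    ext j
    simpa [sub_eq_zero] using hc j y hy
  -- `x` is an isolated point of `V`
  let S : Set (Set (Fin (n + 1) → ℂ)) := {C ∈ components V | x ∉ C}
  have hS : IsVariety (⋃₀ S) := isVariety_sUnion ((finite_components hV).subset fun C hC => hC.1)
    fun C hC => hV.of_mem_components hC.1
  have hU : (⋃₀ S)ᶜ ∈ 𝓝 x := hS.isClosed.isOpen_compl.mem_nhds fun ⟨C, hC, hxC⟩ => hC.2 hxC
  -- Only components through `x` remain in this neighbourhood; each contains `Z = {x}` and equals it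
  -- by maximality.
  have hUV : ∀ y ∈ (⋃₀ S)ᶜ, y ∈ V → y = x := by
    intro y hyS hyV
    obtain ⟨C, hC, hyC⟩ := exists_mem_components hyV
    by_cases hxC : x ∈ C
    · have hZC : Z ⊆ C := fun z hz => by rwa [hZc z hz, ← hZc x hx]
      have : C ⊆ Z := hZ.2 hC.1 hZC
      rw [hZc y (this hyC), hZc x hx]
    · exact absurd ⟨C, ⟨hC, hxC⟩, hyC⟩ hyS
  have h := eventually_exists_mem_of_jacobianX_ne_zero F (hZ.1.2 hx) hJ hU
  obtain ⟨t, ⟨q, hq, hqV, hqt⟩, ht⟩ :=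
    ((h.filter_mono nhdsWithin_le_nhds).and
      (eventually_mem_nhdsWithin (a := x (Fin.last n)) (s := {x (Fin.last n)}ᶜ))).exists
  rw [hUV q hq hqV] at hqt
  exact ht hqt.symm

theorem varietyDim_eq_one_of_jacobianX_ne_zero
    (hZ : Z ∈ components {p | ∀ i, aeval p (F i) = 0})
    {x : Fin (n + 1) → ℂ} (hx : x ∈ Z) (hJ : aeval x (jacobianX F) ≠ 0) : varietyDim Z = 1 := by
  have hp := isPrime_vanishingIdeal hZ.1.1
  exact krullDim_quotient_eq_one (F := F)
    (fun i => (map_mem_vanishingIdeal_iff _).2 fun y hy => hZ.1.2 hy i)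
    (fun h => hJ ((map_mem_vanishingIdeal_iff _).1 h x hx))
    ((isDominantT_iff_transcendental Z).1 (isDominantT_of_jacobianX_ne_zero hZ hx hJ))

theorem mem_dominantPart_of_jacobianX_ne_zero {x : Fin (n + 1) → ℂ}
    (hx : ∀ i, aeval x (F i) = 0) (hJ : aeval x (jacobianX F) ≠ 0) :
    x ∈ dominantPart {p | ∀ i, aeval p (F i) = 0} := by
  obtain ⟨C, hC, hxC⟩ := exists_mem_components (V := {p | ∀ i, aeval p (F i) = 0}) hx
  exact ⟨C, ⟨hC, isDominantT_of_jacobianX_ne_zero hC hxC hJ⟩, hxC⟩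

theorem eventually_exists_mem_of_fibreT {V : Set (Fin (n + 1) → ℂ)}
    (hV : V = {p | ∀ i, aeval p (F i) = 0}) {t₀ : ℂ} (hfin : (fibreT V t₀).Finite)
    (hJ : ∀ p ∈ fibreT V t₀, aeval p (jacobianX F) ≠ 0)
    {U : (Fin (n + 1) → ℂ) → Set (Fin (n + 1) → ℂ)} (hU : ∀ p ∈ fibreT V t₀, U p ∈ 𝓝 p) :
    ∀ᶠ t in 𝓝 t₀, ∀ p ∈ fibreT V t₀, ∃ q ∈ U p, q ∈ fibreT V t := by
  rw [Filter.eventually_all_finite hfin]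
  intro p hp
  have h := eventually_exists_mem_of_jacobianX_ne_zero F (p := p) (by simpa [hV] using hp.1)
    (hJ p hp) (hU p hp)
  rw [hp.2] at h
  filter_upwards [h] with t ⟨q, hq, hqV, hqt⟩
  exact ⟨q, hq, by rw [hV]; exact hqV, hqt⟩

theorem exists_mem_fibreT_of_isDominantT {V : Set (Fin (n + 1) → ℂ)} {D : ℕ}
    (hV : V = {p | ∀ i, aeval p (F i) = 0})
    (hgen : ∀ᶠ t : ℂ in Filter.cofinite, (fibreT V t).encard ≤ D) {t₀ : ℂ}
    (hdeg : (fibreT V t₀).encard = D)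
    (hJ : ∀ p ∈ fibreT V t₀, aeval p (jacobianX F) ≠ 0)
    (hZ : Z ∈ components V) (hdom : IsDominantT Z) : (Z ∩ fibreT V t₀).Nonempty := by
  have hVv : IsVariety V := hV ▸ isVariety_setOf_aeval F
  have hfin : (fibreT V t₀).Finite := Set.finite_of_encard_eq_coe hdeg
  have hZv : IsVariety Z := hVv.of_mem_components hZ
  by_contra hne
  rw [Set.not_nonempty_iff_eq_empty] at hne
  obtain ⟨U, hU, hUd⟩ := hfin.t2_separation
  have h1 := eventually_exists_mem_of_fibreT hV hfin hJ (U := fun p => U p ∩ Zᶜ) fun p hp =>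
    Filter.inter_mem ((hU p).2.mem_nhds (hU p).1) (hZv.isClosed.isOpen_compl.mem_nhds fun h =>
      (Set.eq_empty_iff_forall_notMem.1 hne p) ⟨h, hp⟩)
  have hp := isPrime_vanishingIdeal hZ.1.1
  have h2 := eventually_exists_mem_zeroLocus ((isDominantT_iff_transcendental Z).1 hdom)
  rw [hZv.zeroLocus_vanishingIdeal] at h2
  obtain ⟨t, h1, h2, h3⟩ := ((h1.filter_mono nhdsWithin_le_nhds).and
    ((h2.and hgen).filter_mono (nhdsNE_le_cofinite t₀))).exists (f := 𝓝[≠] t₀)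
  choose! q hqU hqV using h1
  obtain ⟨z, hz, hzt⟩ := h2
  have hinj : Set.InjOn q (fibreT V t₀) := by
    intro a ha b hb hab
    by_contra hne
    exact Set.disjoint_left.1 (hUd ha hb hne) (hqU a ha).1 (hab ▸ (hqU b hb).1)
  have hzq : z ∉ q '' fibreT V t₀ := by
    rintro ⟨a, ha, rfl⟩
    exact (hqU a ha).2 hz
  -- The neighbourhoods were taken disjoint from `Z` and from each other, so these are `D + 1`
  -- distinct points.
  have hsub : insert z (q '' fibreT V t₀) ⊆ fibreT V t := by
    rintro _ (rfl | ⟨a, ha, rfl⟩)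
    · exact ⟨hZ.1.2 hz, hzt⟩
    · exact hqV a ha
  have h4 := (Set.encard_le_encard hsub).trans h3
  rw [Set.encard_insert_of_notMem hzq, hinj.encard_image, hdeg] at h4
  exact absurd h4 (by exact_mod_cast Nat.not_succ_le_self D)

end DominantPart

/-! ### Descent of coefficients from `ℂ` to `ℚ` -/

section Descent

variable {σ : Type}

/-- Apply a `ℚ`-linear functional `ℂ → ℚ` to the coefficients of a polynomial. -/
noncomputable def coeffMap (φ : ℂ →ₗ[ℚ] ℚ) (f : MvPolynomial σ ℂ) : MvPolynomial σ ℚ :=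
  ∑ m ∈ f.support, monomial m (φ (coeff m f))

variable (φ : ℂ →ₗ[ℚ] ℚ)

@[simp]
theorem coeff_coeffMap (f : MvPolynomial σ ℂ) (m : σ →₀ ℕ) :
    coeff m (coeffMap φ f) = φ (coeff m f) := by
  classical
  rw [coeffMap, coeff_sum]
  simp only [coeff_monomial, Finset.sum_ite_eq', mem_support_iff]
  split_ifs with h
  · rfl
  · rw [not_not.1 h, map_zero]

theorem coeffMap_add (f g : MvPolynomial σ ℂ) :
    coeffMap φ (f + g) = coeffMap φ f + coeffMap φ g := by
  ext m; simp

theorem coeffMap_mul_map (f : MvPolynomial σ ℂ) (q : MvPolynomial σ ℚ) :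
    coeffMap φ (f * map (algebraMap ℚ ℂ) q) = coeffMap φ f * q := by
  classical
  ext m
  rw [coeff_coeffMap, coeff_mul, coeff_mul, map_sum]
  refine Finset.sum_congr rfl fun x _ => ?_
  rw [coeff_map, coeff_coeffMap, mul_comm, ← Algebra.smul_def, map_smul, smul_eq_mul, mul_comm]

theorem coeffMap_aeval_map {τ : Type} (s : τ → MvPolynomial σ ℚ) (g : MvPolynomial τ ℂ) :
    coeffMap φ (aeval (fun i => map (algebraMap ℚ ℂ) (s i)) g) = aeval s (coeffMap φ g) := by
  induction g using MvPolynomial.induction_on' with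
  | add f g hf hg => rw [map_add, coeffMap_add, hf, hg, coeffMap_add, map_add]
  | monomial m c =>
    have h1 : ∀ (υ : Type) (n : υ →₀ ℕ), coeffMap φ (monomial n c) = monomial n (φ c) := by
      classical
      intro υ n
      ext k
      rw [coeff_coeffMap, coeff_monomial, coeff_monomial]
      split_ifs <;> simp
    have h2 : aeval (fun i => map (algebraMap ℚ ℂ) (s i)) (monomial m c) =
        monomial 0 c * map (algebraMap ℚ ℂ) (m.prod fun i k => s i ^ k) := by
      rw [aeval_monomial, map_finsuppProd]
      simp only [map_pow]; rfl
    rw [h2, coeffMap_mul_map, h1, h1, aeval_monomial]; rfl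

/-- `coeffMap φ` is linear over rational polynomials, so it sends a complex combination of elements
of `I` to a rational one. -/
theorem coeffMap_mem_of_mem_map {I : Ideal (MvPolynomial σ ℚ)} {f : MvPolynomial σ ℂ}
    (hf : f ∈ I.map (map (algebraMap ℚ ℂ))) : coeffMap φ f ∈ I := by
  -- `coeffMap φ` does not respect complex multipliers, so they have to be carried through the
  -- induction.
  suffices h : ∀ a, coeffMap φ (a * f) ∈ I by simpa using h 1
  induction hf using Submodule.span_induction with
  | mem x hx =>
    obtain ⟨q, hq, rfl⟩ := hx
    intro a
    rw [coeffMap_mul_map]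
    exact I.mul_mem_left _ hq
  | zero =>
    intro a
    have : coeffMap φ (0 : MvPolynomial σ ℂ) = 0 := by ext m; simp
    rw [mul_zero, this]
    exact I.zero_mem
  | add x y _ _ hx hy =>
    intro a
    rw [mul_add, coeffMap_add]
    exact I.add_mem (hx a) (hy a)
  | smul b x _ hx =>
    intro a
    rw [smul_eq_mul, ← mul_assoc]
    exact hx _

/-- Expanding the coefficients in a `ℚ`-basis of `ℂ` writes `f` as a complex combination of the
polynomials `coeffMap φ f`, with `φ` the coordinate functionals. -/
theorem aeval_eq_zero_of_coeffMap {f : MvPolynomial σ ℂ} {x : σ → ℂ}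
    (h : ∀ φ : ℂ →ₗ[ℚ] ℚ, aeval x (coeffMap φ f) = 0) : aeval x f = 0 := by
  classical
  let b := Module.Basis.ofVectorSpace ℚ ℂ
  let T := f.support.biUnion fun m => (b.repr (coeff m f)).support
  have hf : f = ∑ i ∈ T, C (b i) * map (algebraMap ℚ ℂ) (coeffMap (b.coord i) f) := by
    ext m
    rw [coeff_sum]
    simp only [coeff_C_mul, coeff_map, coeff_coeffMap, Module.Basis.coord_apply]
    conv_lhs => rw [← b.linearCombination_repr (coeff m f), Finsupp.linearCombination_apply]
    have hT : (b.repr (coeff m f)).support ⊆ T := by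
      by_cases hm : m ∈ f.support
      · exact Finset.subset_biUnion_of_mem (fun m => (b.repr (coeff m f)).support) hm
      · rw [notMem_support_iff.1 hm]; simp
    rw [Finsupp.sum_of_support_subset _ hT _ (by simp)]
    exact Finset.sum_congr rfl fun i _ => by rw [Algebra.smul_def, mul_comm]
  rw [hf, map_sum]
  refine Finset.sum_eq_zero fun i _ => ?_
  rw [map_mul, aeval_map_algebraMap, h, mul_zero]

theorem exists_pow_coeffMap_mem [Finite σ] {I : Ideal (MvPolynomial σ ℚ)} {f : MvPolynomial σ ℂ}
    (hf : ∀ x ∈ zeroLocus ℂ I, aeval x f = 0) :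
    ∃ k, ∀ φ : ℂ →ₗ[ℚ] ℚ, coeffMap φ (f ^ k) ∈ I := by
  have h : f ∈ vanishingIdeal ℂ (zeroLocus ℂ (I.map (map (algebraMap ℚ ℂ)))) := by
    intro x hx
    refine hf x fun q hq => ?_
    rw [← aeval_map_algebraMap ℂ]
    exact hx _ (Ideal.mem_map_of_mem _ hq)
  rw [vanishingIdeal_zeroLocus_eq_radical] at h
  obtain ⟨k, hk⟩ := h
  exact ⟨k, fun φ => coeffMap_mem_of_mem_map φ hk⟩

end Descent

/-! ### The dominant part and the saturation -/

theorem zeroLocus_span_range {σ ι : Type} (F : ι → MvPolynomial σ ℚ) :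
    zeroLocus ℂ (Ideal.span (Set.range F)) = {p | ∀ i, aeval p (F i) = 0} := by
  rw [zeroLocus_span]
  ext p
  simp [aeval_def]

theorem isVariety_dominantPart {n : ℕ} {V : Set (Fin (n + 1) → ℂ)} (hV : IsVariety V) :
    IsVariety (dominantPart V) :=
  isVariety_sUnion ((finite_components hV).subset fun _ hC => hC.1)
    fun _ hC => hV.of_mem_components hC.1

theorem zeroLocus_saturation_subset_dominantPart {n : ℕ}
    (F : Fin n → MvPolynomial (Fin (n + 1)) ℚ) :
    zeroLocus ℂ (saturation (Ideal.span (Set.range F)) (jacobianX F)) ⊆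
      dominantPart {p | ∀ i, aeval p (F i) = 0} := by
  intro q hq
  have hV := isVariety_dominantPart (isVariety_setOf_aeval F)
  rw [← hV.zeroLocus_vanishingIdeal]
  intro g hg
  obtain ⟨k, hk⟩ := exists_pow_coeffMap_mem (I := Ideal.span (Set.range F))
    (f := g * map (algebraMap ℚ ℂ) (jacobianX F)) (by
      intro x hx
      rw [zeroLocus_span_range] at hx
      rw [map_mul, aeval_map_algebraMap, mul_eq_zero, or_iff_not_imp_right]
      exact fun hJ => hg x (mem_dominantPart_of_jacobianX_ne_zero hx hJ))
  -- Since `J` is rational, `coeffMap φ ((g * J) ^ k) = coeffMap φ (g ^ k) * J ^ k`, which places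
  -- `coeffMap φ (g ^ k)` in the saturation.
  have h : aeval q (g ^ k) = 0 := aeval_eq_zero_of_coeffMap fun φ => hq _ ⟨k, by
    have := hk φ
    rwa [mul_pow, ← map_pow, coeffMap_mul_map, mul_comm] at this⟩
  rw [map_pow] at h
  exact eq_zero_of_pow_eq_zero h

theorem subset_zeroLocus_saturation {n : ℕ} {F : Fin n → MvPolynomial (Fin (n + 1)) ℚ}
    {Z : Set (Fin (n + 1) → ℂ)} (hZ : Z ∈ components {p | ∀ i, aeval p (F i) = 0})
    {x : Fin (n + 1) → ℂ} (hx : x ∈ Z) (hJ : aeval x (jacobianX F) ≠ 0) :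
    Z ⊆ zeroLocus ℂ (saturation (Ideal.span (Set.range F)) (jacobianX F)) := by
  intro y hy f ⟨k, hk⟩
  have hp := isPrime_vanishingIdeal hZ.1.1
  have h : map (algebraMap ℚ ℂ) (jacobianX F ^ k * f) ∈ vanishingIdeal ℂ Z := by
    rw [map_mem_vanishingIdeal_iff]
    intro z hz
    have : z ∈ zeroLocus ℂ (Ideal.span (Set.range F)) := zeroLocus_span_range F ▸ hZ.1.2 hz
    exact this _ hk
  rw [map_mul, map_pow] at h
  rcases hp.mem_or_mem h with h | h
  · exact absurd ((map_mem_vanishingIdeal_iff _).1 (hp.mem_of_pow_mem _ h) x hx) hJ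
  · exact (map_mem_vanishingIdeal_iff _).1 h y hy

/-! ### Ideals of polynomials that are saturated with respect to the constants -/

section Saturated

open Polynomial

variable {R : Type*} [CommRing R] [IsDomain R] [UniqueFactorizationMonoid R]

/-- Over the fraction field the ideal is generated by an element of least degree. Saturation allows
its content to be removed, and Gauss's lemma brings divisibility back to `R`. -/
theorem exists_isPrimitive_span_eq {I : Ideal R[X]} (hI : I ≠ ⊥)
    (hsat : ∀ (r : R) (g : R[X]), r ≠ 0 → Polynomial.C r * g ∈ I → g ∈ I) :
    ∃ M : R[X], M.IsPrimitive ∧ I = Ideal.span {M} := by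
  classical
  let _ : NormalizedGCDMonoid R := Classical.choice
    (inferInstanceAs (Nonempty (NormalizedGCDMonoid R)))
  let K := FractionRing R
  obtain ⟨f, hfI, hf0⟩ := Submodule.exists_mem_ne_zero_of_ne_bot hI
  have hex : ∃ d, ∃ f ∈ I, f ≠ 0 ∧ f.natDegree = d := ⟨_, f, hfI, hf0, rfl⟩
  obtain ⟨M₀, hM₀, hM₀0, hdeg⟩ := Nat.find_spec hex
  have hmin : ∀ g ∈ I, g.natDegree < M₀.natDegree → g = 0 := by
    intro g hg hlt
    by_contra h0
    exact Nat.find_min hex (hdeg ▸ hlt) ⟨g, hg, h0, rfl⟩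
  have hc : M₀.content ≠ 0 := content_eq_zero_iff.not.2 hM₀0
  have hMI : M₀.primPart ∈ I := hsat M₀.content _ hc (by rwa [← eq_C_content_mul_primPart])
  have hMp : M₀.primPart.IsPrimitive := isPrimitive_primPart M₀
  rw [← natDegree_primPart] at hmin
  generalize M₀.primPart = M at hMI hMp hmin
  refine ⟨M, hMp, le_antisymm (fun g hg => ?_) ((Ideal.span_singleton_le_iff_mem _).2 hMI)⟩
  rw [Ideal.mem_span_singleton]
  by_cases hg0 : g = 0
  · rw [hg0]; exact dvd_zero _
  have hMK : M.map (algebraMap R K) ≠ 0 :=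
    (Polynomial.map_ne_zero_iff (IsFractionRing.injective R K)).2 hMp.ne_zero
  -- After clearing the denominator `b` of the quotient, the remainder becomes an element of `I` of
  -- degree below the minimum.
  have hmod : g.map (algebraMap R K) % M.map (algebraMap R K) = 0 := by
    obtain ⟨b, hbR, hb⟩ := IsLocalization.integerNormalization_spec (nonZeroDivisors R)
      (g.map (algebraMap R K) / M.map (algebraMap R K))
    set q := IsLocalization.integerNormalization (nonZeroDivisors R)
      (g.map (algebraMap R K) / M.map (algebraMap R K))
    have hb0 : b ≠ 0 := nonZeroDivisors.ne_zero hbR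
    have hmap : (Polynomial.C b * g - M * q).map (algebraMap R K) =
        Polynomial.C (algebraMap R K b) * (g.map (algebraMap R K) % M.map (algebraMap R K)) := by
      rw [Polynomial.map_sub, Polynomial.map_mul, Polynomial.map_mul, hb, Polynomial.map_C,
        EuclideanDomain.mod_eq_sub_mul_div, mul_sub]
      congr 1
      rw [Algebra.smul_def, Polynomial.algebraMap_apply]
      ring
    by_contra hne
    have hlt : (Polynomial.C b * g - M * q).natDegree < M.natDegree := by
      rw [← Polynomial.natDegree_map_eq_of_injective (IsFractionRing.injective R K)
        (Polynomial.C b * g - M * q), hmap, Polynomial.natDegree_C_mul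
        ((map_ne_zero_iff _ (IsFractionRing.injective R K)).2 hb0),
        ← Polynomial.natDegree_map_eq_of_injective (IsFractionRing.injective R K) M]
      exact Polynomial.natDegree_lt_natDegree hne (EuclideanDomain.mod_lt _ hMK)
    have h0 := hmin _ (I.sub_mem (I.mul_mem_left _ hg) (I.mul_mem_right _ hMI)) hlt
    rw [h0, Polynomial.map_zero, eq_comm, mul_eq_zero, Polynomial.C_eq_zero,
      map_eq_zero_iff _ (IsFractionRing.injective R K)] at hmap
    exact hmap.elim hb0 hne
  exact hMp.dvd_of_fraction_map_dvd_fraction_map (K := K) (EuclideanDomain.mod_eq_zero.1 hmod)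

theorem separable_map_of_isRadical {K : Type*} [Field K] [CharZero K] [Algebra R K]
    [IsFractionRing R K] {M : R[X]} (hM : M.IsPrimitive) (hrad : (Ideal.span {M}).IsRadical) :
    (M.map (algebraMap R K)).Separable := by
  classical
  let _ : NormalizedGCDMonoid R := Classical.choice
    (inferInstanceAs (Nonempty (NormalizedGCDMonoid R)))
  rw [PerfectField.separable_iff_squarefree]
  rintro a ⟨c, hc⟩
  have hMK : M.map (algebraMap R K) ≠ 0 :=
    (Polynomial.map_ne_zero_iff (IsFractionRing.injective R K)).2 hM.ne_zero
  have hac : a * c ≠ 0 := by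
    intro h
    rw [mul_assoc, h, mul_zero] at hc
    exact hMK hc
  obtain ⟨b, hbR, hb⟩ := IsLocalization.integerNormalization_spec (nonZeroDivisors R) (a * c)
  set N := IsLocalization.integerNormalization (nonZeroDivisors R) (a * c)
  rw [Algebra.smul_def, Polynomial.algebraMap_apply] at hb
  have hb0 : algebraMap R K b ≠ 0 :=
    (map_ne_zero_iff _ (IsFractionRing.injective R K)).2 (nonZeroDivisors.ne_zero hbR)
  -- Over `K`, `M = a²c` divides `(ac)²`. Radicality then gives `M ∣ N`, where `N = b·ac`, and
  -- cancelling `ac` leaves `a ∣ b`, a unit.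
  have h1 : M ∣ N ^ 2 := by
    refine hM.dvd_of_fraction_map_dvd_fraction_map (K := K) ?_
    rw [Polynomial.map_pow, hb, hc]
    exact ⟨Polynomial.C (algebraMap R K b) ^ 2 * c, by ring⟩
  have h2 : M ∣ N := Ideal.mem_span_singleton.1 (hrad ⟨2, Ideal.mem_span_singleton.2 h1⟩)
  have h3 : M.map (algebraMap R K) ∣ N.map (algebraMap R K) := Polynomial.map_dvd _ h2
  rw [hb, hc] at h3
  obtain ⟨d, hd⟩ := h3
  have h4 : Polynomial.C (algebraMap R K b) = a * d := by
    refine mul_right_cancel₀ hac ?_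
    rw [hd]; ring
  exact isUnit_of_dvd_unit ⟨d, h4⟩ (Polynomial.isUnit_C.2 hb0.isUnit)

theorem separable_map_of_injective [CharZero R] {L : Type*} [Field L] {φ : R →+* L}
    (hφ : Function.Injective φ) {M : R[X]} (hM : M.IsPrimitive)
    (hrad : (Ideal.span {M}).IsRadical) : (M.map φ).Separable := by
  have h := (separable_map_of_isRadical (K := FractionRing R) hM hrad).map
    (f := IsFractionRing.lift hφ)
  rw [Polynomial.map_map] at h
  have : (IsFractionRing.lift hφ).comp (algebraMap R (FractionRing R)) = φ :=
    RingHom.ext fun r => IsFractionRing.lift_algebraMap hφ r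
  rwa [this] at h

end Saturated

/-! ### Bivariate polynomials as polynomials in `Y` -/

/-- `ℚ[T, Y]` as the ring of polynomials in `Y` over `ℚ[T]`. -/
noncomputable def polyInY :
    MvPolynomial (Fin 2) ℚ ≃ₐ[ℚ] Polynomial (MvPolynomial (Fin 1) ℚ) :=
  -- `finSuccEquiv` singles out variable `0`, so the swap first moves `Y` there.
  (renameEquiv ℚ (Equiv.swap (0 : Fin 2) 1)).trans (finSuccEquiv ℚ 1)

theorem polyInY_X_zero : polyInY (X 0) = Polynomial.C (X 0) := by
  have h : Equiv.swap (0 : Fin 2) 1 0 = Fin.succ 0 := by simp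
  simp only [polyInY, AlgEquiv.trans_apply, renameEquiv_apply, rename_X, h]
  exact finSuccEquiv_X_succ

theorem polyInY_X_one : polyInY (X 1) = Polynomial.X := by
  simp [polyInY, finSuccEquiv_X_zero]

theorem natDegree_polyInY (M : MvPolynomial (Fin 2) ℚ) :
    (polyInY M).natDegree = M.degreeOf 1 := by
  have h := degreeOf_rename_of_injective (p := M) (Equiv.swap (0 : Fin 2) 1).injective 1
  rw [Equiv.swap_apply_right] at h
  rw [← h, ← natDegree_finSuccEquiv]; rfl

theorem polyInY_symm_C (r : MvPolynomial (Fin 1) ℚ) :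
    polyInY.symm (Polynomial.C r) = rename (fun _ => 0) r := by
  rw [AlgEquiv.symm_apply_eq]
  have : (polyInY.toAlgHom.comp (rename fun _ => 0)) =
      (IsScalarTower.toAlgHom ℚ (MvPolynomial (Fin 1) ℚ)
        (Polynomial (MvPolynomial (Fin 1) ℚ))) := by
    ext i : 1
    rw [Subsingleton.elim i 0]
    simpa using polyInY_X_zero
  exact (DFunLike.congr_fun this r).symm

theorem aeval_polyInY {B : Type*} [CommRing B] [Algebra ℚ B] [Algebra (MvPolynomial (Fin 1) ℚ) B]
    [IsScalarTower ℚ (MvPolynomial (Fin 1) ℚ) B] (y : B) (g : MvPolynomial (Fin 2) ℚ) :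
    Polynomial.aeval y (polyInY g) =
      aeval ![algebraMap (MvPolynomial (Fin 1) ℚ) B (X 0), y] g := by
  have : (((Polynomial.aeval y).restrictScalars ℚ).comp polyInY.toAlgHom :
      MvPolynomial (Fin 2) ℚ →ₐ[ℚ] B) =
      aeval ![algebraMap (MvPolynomial (Fin 1) ℚ) B (X 0), y] := by
    ext i
    fin_cases i
    · simp [polyInY_X_zero]
    · simp [polyInY_X_one]
  exact DFunLike.congr_fun this g

/-! ### Lifting points over a transcendental `t` -/

theorem isAlgebraic_quotient_of_forall_X {σ : Type} (i₀ : σ) {q : Ideal (MvPolynomial σ ℚ)}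
    [q.IsPrime] [Algebra (MvPolynomial (Fin 1) ℚ) (MvPolynomial σ ℚ ⧸ q)]
    (hX : algebraMap (MvPolynomial (Fin 1) ℚ) (MvPolynomial σ ℚ ⧸ q) (X 0) =
      Ideal.Quotient.mk q (X i₀))
    (h : ∀ i, ∃ g : MvPolynomial (Fin 2) ℚ, g ≠ 0 ∧ aeval ![X i₀, X i] g ∈ q) :
    Algebra.IsAlgebraic (MvPolynomial (Fin 1) ℚ) (MvPolynomial σ ℚ ⧸ q) := by
  have hT : IsScalarTower ℚ (MvPolynomial (Fin 1) ℚ) (MvPolynomial σ ℚ ⧸ q) :=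
    .of_algebraMap_eq' (Subsingleton.elim _ _)
  have hgen : ∀ i, IsAlgebraic (MvPolynomial (Fin 1) ℚ) (Ideal.Quotient.mk q (X i)) := by
    intro i
    obtain ⟨g, hg0, hg⟩ := h i
    refine ⟨polyInY g, by simpa using hg0, ?_⟩
    rw [aeval_polyInY, hX]
    have : aeval ![Ideal.Quotient.mk q (X i₀), Ideal.Quotient.mk q (X i)] =
        (Ideal.Quotient.mkₐ ℚ q).comp (aeval ![X i₀, X i]) := by
      ext j
      fin_cases j <;> simp
    rw [this]
    exact Ideal.Quotient.eq_zero_iff_mem.2 hg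
  refine ⟨fun a => ?_⟩
  obtain ⟨f, rfl⟩ := Ideal.Quotient.mk_surjective a
  induction f using MvPolynomial.induction_on with
  | C c =>
    have : Ideal.Quotient.mk q (C c) =
        algebraMap (MvPolynomial (Fin 1) ℚ) (MvPolynomial σ ℚ ⧸ q) (C c) := by
      have h2 := IsScalarTower.algebraMap_apply ℚ (MvPolynomial (Fin 1) ℚ)
        (MvPolynomial σ ℚ ⧸ q) c
      exact h2
    rw [this]
    exact isAlgebraic_algebraMap _
  | add f g hf hg => rw [map_add]; exact hf.add hg
  | mul_X f i hf => rw [map_mul]; exact hf.mul (hgen i)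

theorem eq_zero_of_aeval_rename_eq_zero {σ : Type} {x : σ → ℂ} {i₀ : σ}
    (ht : Transcendental ℚ (x i₀)) {r : MvPolynomial (Fin 1) ℚ}
    (h : aeval x (rename (fun _ => i₀) r) = 0) : r = 0 := by
  have hi := (algebraicIndependent_unique_type_iff (ι := Fin 1) (R := ℚ)
    (x := fun _ : Fin 1 => x i₀)).2 ht
  rw [algebraicIndependent_iff] at hi
  rw [aeval_rename] at h
  exact hi r h

/-- A homomorphism to `ℂ` extends along an algebraic extension with the same kernel. -/
theorem exists_ringHom_comp_algebraMap_eq {R S E : Type} [CommRing R] [CommRing S] [CommRing E]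
    [IsDomain R] [IsDomain E] [Algebra R S] [Algebra S E] [Algebra R E] [IsScalarTower R S E]
    [Algebra.IsAlgebraic R E] (ev : S →+* ℂ) (hker : RingHom.ker (algebraMap S E) = RingHom.ker ev)
    (hinj : Function.Injective (ev.comp (algebraMap R S))) :
    ∃ ψ : E →+* ℂ, ψ.comp (algebraMap S E) = ev := by
  -- Having the same kernel, both maps factor injectively through `S₁`. As `E` is algebraic over
  -- `S₁`, the embedding of `S₁` in `ℂ` extends to `E`.
  let S₁ := S ⧸ RingHom.ker ev
  let _ : Algebra S₁ E := (Ideal.Quotient.lift (RingHom.ker ev) (algebraMap S E)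
    fun a ha => by rwa [← hker] at ha).toAlgebra
  let _ : Algebra S₁ ℂ := (RingHom.kerLift ev).toAlgebra
  have hinjC : Function.Injective (algebraMap S₁ ℂ) := RingHom.kerLift_injective ev
  have hinjE : Function.Injective (algebraMap S₁ E) := by
    refine (injective_iff_map_eq_zero _).2 fun a ha => ?_
    obtain ⟨g, rfl⟩ := Ideal.Quotient.mk_surjective a
    have : g ∈ RingHom.ker (algebraMap S E) := ha
    rw [hker] at this
    exact Ideal.Quotient.eq_zero_iff_mem.2 this
  have : IsScalarTower R S₁ E := .of_algebraMap_eq fun r => by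
    rw [IsScalarTower.algebraMap_apply R S E]; rfl
  have : Algebra.IsAlgebraic S₁ E := Algebra.IsAlgebraic.extendScalars (R := R) <| by
    refine .of_comp (f := algebraMap S₁ ℂ) ?_
    exact hinj
  have : FaithfulSMul S₁ E := (faithfulSMul_iff_algebraMap_injective _ _).2 hinjE
  have : FaithfulSMul S₁ ℂ := (faithfulSMul_iff_algebraMap_injective _ _).2 hinjC
  have : IsDomain S₁ := hinjE.isDomain _
  let ψ : E →ₐ[S₁] ℂ := IsAlgClosed.lift
  refine ⟨ψ, RingHom.ext fun g => ?_⟩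
  exact ψ.commutes (Ideal.Quotient.mk _ g)

theorem exists_ringHom_comp_eq {R S E : Type} [CommRing R] [CommRing S] [CommRing E]
    [IsDomain R] [IsDomain E] (i : R →+* S) (f : S →+* E) (ev : S →+* ℂ)
    (halg : ∀ a, ∃ g : Polynomial R, g ≠ 0 ∧ g.eval₂ (f.comp i) a = 0)
    (hker : ∀ a, f a = 0 ↔ ev a = 0) (hinj : ∀ r, ev (i r) = 0 → r = 0) :
    ∃ ψ : E →+* ℂ, ψ.comp f = ev := by
  let _ := i.toAlgebra
  let _ := f.toAlgebra
  let _ := (f.comp i).toAlgebra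
  have : IsScalarTower R S E := .of_algebraMap_eq' rfl
  have : Algebra.IsAlgebraic R E := ⟨halg⟩
  exact exists_ringHom_comp_algebraMap_eq (R := R) ev (Ideal.ext hker)
    ((injective_iff_map_eq_zero _).2 hinj)

theorem isAlgebraic_quotient {σ : Type} (i₀ : σ) {q : Ideal (MvPolynomial σ ℚ)} [q.IsPrime]
    (h : ∀ i, ∃ g : MvPolynomial (Fin 2) ℚ, g ≠ 0 ∧ aeval ![X i₀, X i] g ∈ q)
    (a : MvPolynomial σ ℚ ⧸ q) : ∃ g : Polynomial (MvPolynomial (Fin 1) ℚ), g ≠ 0 ∧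
      g.eval₂ ((Ideal.Quotient.mk q).comp (rename fun _ => i₀).toRingHom) a = 0 := by
  let _ := ((Ideal.Quotient.mk q).comp
    (rename fun _ : Fin 1 => i₀ : MvPolynomial (Fin 1) ℚ →ₐ[ℚ] _).toRingHom).toAlgebra
  have := isAlgebraic_quotient_of_forall_X i₀ (q := q)
    (congrArg (Ideal.Quotient.mk q) (rename_X (fun _ : Fin 1 => i₀) 0)) h
  exact Algebra.IsAlgebraic.isAlgebraic (R := MvPolynomial (Fin 1) ℚ) a

/-- The relation `g` makes the quotient by any prime `p₀` over `I` algebraic over `ℚ[T]`. A prime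
strictly above `p₀` would then contain a nonzero element of `ℚ[T]`. -/
theorem mem_minimalPrimes_of_ne_zero {I p : Ideal (MvPolynomial (Fin 2) ℚ)} [hp : p.IsPrime]
    {g : MvPolynomial (Fin 2) ℚ} (hg0 : g ≠ 0) (hg : g ∈ I) (hle : I ≤ p)
    (hpR : ∀ r : MvPolynomial (Fin 1) ℚ, rename (fun _ => 0) r ∈ p → r = 0) :
    p ∈ I.minimalPrimes := by
  refine ⟨⟨hp, hle⟩, fun p₀ ⟨hp₀, hI⟩ hle f hf => ?_⟩
  let _ : Algebra (MvPolynomial (Fin 1) ℚ) (MvPolynomial (Fin 2) ℚ ⧸ p₀) :=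
    ((Ideal.Quotient.mk p₀).comp (rename fun _ => 0).toRingHom).toAlgebra
  have hmap : ∀ r, algebraMap (MvPolynomial (Fin 1) ℚ) (MvPolynomial (Fin 2) ℚ ⧸ p₀) r =
    Ideal.Quotient.mk p₀ (rename (fun _ => 0) r) := fun _ => rfl
  have := isAlgebraic_quotient_of_forall_X (q := p₀) (0 : Fin 2) (by rw [hmap, rename_X]) (by
    refine Fin.forall_fin_two.2
      ⟨⟨X 0 - X 1, sub_ne_zero.2 fun h => by simpa using X_injective h, by simp⟩,
        ⟨g, hg0, hI ?_⟩⟩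
    have : (![X 0, X 1] : Fin 2 → MvPolynomial (Fin 2) ℚ) = X := by
      ext1 j; fin_cases j <;> rfl
    rw [this, aeval_X_left_apply]
    exact hg)
  by_contra hf0
  have hne := Ideal.comap_ne_bot_of_algebraic_mem (R := MvPolynomial (Fin 1) ℚ)
    (I := p.map (Ideal.Quotient.mk p₀)) (x := Ideal.Quotient.mk p₀ f)
    (fun h => hf0 (Ideal.Quotient.eq_zero_iff_mem.1 h)) (Ideal.mem_map_of_mem _ hf)
    (Algebra.IsAlgebraic.isAlgebraic _)
  refine hne (eq_bot_iff.2 fun r hr => ?_)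
  rw [Ideal.mem_comap, hmap, Ideal.mem_quotient_iff_mem hle] at hr
  exact hpR r hr

/-- The kernel of evaluation at `(t, y)` meets `ℚ[T]` trivially, so it is a minimal prime of the
contraction of `I` and hence contracted from a prime `q ⊇ I`. The quotient by `q` is algebraic over
`ℚ[T]`, so the evaluation extends to it, giving a point. -/
theorem exists_mem_zeroLocus_of_transcendental {σ : Type} {I : Ideal (MvPolynomial σ ℚ)} {i₀ : σ}
    {w : MvPolynomial σ ℚ} (halg : ∀ f, ∃ g : MvPolynomial (Fin 2) ℚ, g ≠ 0 ∧
      aeval ![X i₀, f] g ∈ I) {t y : ℂ} (ht : Transcendental ℚ t)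
    (hy : ∀ g : MvPolynomial (Fin 2) ℚ, aeval ![X i₀, w] g ∈ I → aeval ![t, y] g = 0) :
    ∃ x ∈ zeroLocus ℂ I, x i₀ = t ∧ aeval x w = y := by
  let s : MvPolynomial (Fin 2) ℚ →ₐ[ℚ] MvPolynomial σ ℚ := aeval ![X i₀, w]
  let ev : MvPolynomial (Fin 2) ℚ →ₐ[ℚ] ℂ := aeval ![t, y]
  have hs0 : ∀ r : MvPolynomial (Fin 1) ℚ, s (rename (fun _ => 0) r) = rename (fun _ => i₀) r := by
    intro r
    have : s.comp (rename fun _ : Fin 1 => 0) = rename fun _ => i₀ := by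
      ext1 i
      simp [s]
    exact DFunLike.congr_fun this r
  let p : Ideal (MvPolynomial (Fin 2) ℚ) := RingHom.ker ev
  have hp : p.IsPrime := RingHom.ker_isPrime ev
  have hpR : ∀ r : MvPolynomial (Fin 1) ℚ, rename (fun _ => 0) r ∈ p → r = 0 := fun r hr =>
    eq_zero_of_aeval_rename_eq_zero (x := ![t, y]) (i₀ := (0 : Fin 2)) ht hr
  have hmin : p ∈ (I.comap s).minimalPrimes := by
    obtain ⟨g, hg0, hg⟩ := halg w
    exact mem_minimalPrimes_of_ne_zero (I := I.comap s) hg0 hg (fun g hg => hy g hg) hpR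
  obtain ⟨q, hq, hqp⟩ := Ideal.exists_minimalPrimes_comap_eq s.toRingHom p hmin
  have hqprime : q.IsPrime := hq.1.1
  have hIq : I ≤ q := hq.1.2
  have hψ : ∃ ψ : MvPolynomial σ ℚ ⧸ q →+* ℂ,
      ψ.comp ((Ideal.Quotient.mk q).comp s.toRingHom) = ev.toRingHom := by
    have halg' := isAlgebraic_quotient i₀ (q := q) fun i => by
      obtain ⟨g, hg0, hg⟩ := halg (X i)
      exact ⟨g, hg0, hIq hg⟩
    have h2 : (Ideal.Quotient.mk q).comp (rename fun _ : Fin 1 => i₀).toRingHom =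
        ((Ideal.Quotient.mk q).comp s.toRingHom).comp
          (rename fun _ : Fin 1 => (0 : Fin 2)).toRingHom := by
      refine RingHom.ext fun r => ?_
      simp [hs0]
    rw [h2] at halg'
    refine exists_ringHom_comp_eq _ _ _ halg' (fun g => ?_) fun r hr => hpR r ?_
    · rw [RingHom.comp_apply, Ideal.Quotient.eq_zero_iff_mem]
      have := SetLike.ext_iff.1 hqp g
      rw [Ideal.mem_comap, RingHom.mem_ker] at this
      exact this
    · rw [RingHom.mem_ker]
      exact hr
  obtain ⟨ψ, hψ⟩ := hψ
  have hψf : ∀ f, aeval (fun i => ψ (Ideal.Quotient.mk q (X i))) f =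
      ψ (Ideal.Quotient.mk q f) := by
    intro f
    have : (aeval (fun i => ψ (Ideal.Quotient.mk q (X i))) : MvPolynomial σ ℚ →ₐ[ℚ] ℂ) =
        (ψ.comp (Ideal.Quotient.mk q)).toRatAlgHom := by
      ext i
      simp
    rw [this]; rfl
  have hψs : ∀ g, ψ (Ideal.Quotient.mk q (s g)) = ev g := fun g => DFunLike.congr_fun hψ g
  refine ⟨fun i => ψ (Ideal.Quotient.mk q (X i)), fun f hf => ?_, ?_, ?_⟩
  · rw [hψf, Ideal.Quotient.eq_zero_iff_mem.2 (hIq hf), map_zero]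
  · have := hψs (X 0)
    simpa [s, ev] using this
  · rw [hψf]
    have := hψs (X 1)
    simpa [s, ev] using this

/-! ### The degree of the projection -/

/-- The closure is defined over `ℚ`: pulling a complex equation `g` back to the source, the
Nullstellensatz and the coefficient functionals split a power of `g` into rational equations of the
image. -/
theorem zariskiClosure_image_aeval {σ τ : Type} [Finite σ] (I : Ideal (MvPolynomial σ ℚ))
    (s : τ → MvPolynomial σ ℚ) :
    zariskiClosure ((fun (x : σ → ℂ) i => aeval x (s i)) '' zeroLocus ℂ I) =
      zeroLocus ℂ (vanishingIdeal ℚ ((fun (x : σ → ℂ) i => aeval x (s i)) '' zeroLocus ℂ I)) := by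
  rw [zariskiClosure_eq]
  refine Set.Subset.antisymm (fun y hy f hf => ?_) fun y hy g hg => ?_
  · rw [← aeval_map_algebraMap ℂ]
    exact hy _ ((map_mem_vanishingIdeal_iff f).2 hf)
  · have hcomp : ∀ (x : σ → ℂ) (g : MvPolynomial τ ℂ),
        aeval x (aeval (fun i => map (algebraMap ℚ ℂ) (s i)) g) =
          aeval (fun i => aeval x (s i)) g := by
      intro x g
      rw [← AlgHom.comp_apply, comp_aeval]
      simp only [aeval_map_algebraMap]
    have hcomp' : ∀ (x : σ → ℂ) (g : MvPolynomial τ ℚ),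
        aeval x (aeval s g) = aeval (fun i => aeval x (s i)) g := by
      intro x g
      rw [← AlgHom.comp_apply (aeval x : MvPolynomial σ ℚ →ₐ[ℚ] ℂ), comp_aeval]
    obtain ⟨k, hk⟩ := exists_pow_coeffMap_mem (I := I)
      (f := aeval (fun i => map (algebraMap ℚ ℂ) (s i)) g) fun x hx => by
        rw [hcomp]
        exact hg _ ⟨x, hx, rfl⟩
    have h : aeval y (g ^ k) = 0 := aeval_eq_zero_of_coeffMap fun φ => hy _ <| by
      rintro _ ⟨x, hx, rfl⟩
      rw [← hcomp', ← coeffMap_aeval_map, map_pow]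
      exact hx _ (hk φ)
    rw [map_pow] at h
    exact eq_zero_of_pow_eq_zero h

/-! ### Algebraic relations between `T` and a second function -/

section Relations

variable {n : ℕ} {F : Fin n → MvPolynomial (Fin (n + 1)) ℚ} {Z : Set (Fin (n + 1) → ℂ)}

theorem exists_relation_of_jacobianX_ne_zero
    (hZ : Z ∈ components {p | ∀ i, aeval p (F i) = 0})
    {x : Fin (n + 1) → ℂ} (hx : x ∈ Z) (hJ : aeval x (jacobianX F) ≠ 0)
    (w : MvPolynomial (Fin (n + 1)) ℂ) :
    ∃ g : MvPolynomial (Fin 2) ℂ, g ≠ 0 ∧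
      aeval ![X (Fin.last n), w] g ∈ vanishingIdeal ℂ Z := by
  have hp := isPrime_vanishingIdeal hZ.1.1
  have htr := trdeg_quotient_le_one (F := F) (p := vanishingIdeal ℂ Z)
    (fun i => (map_mem_vanishingIdeal_iff _).2 fun y hy => hZ.1.2 hy i)
    (fun h => hJ ((map_mem_vanishingIdeal_iff _).1 h x hx))
  have hdep : ¬ AlgebraicIndependent ℂ
      (fun i => Ideal.Quotient.mk (vanishingIdeal ℂ Z) (![X (Fin.last n), w] i)) := by
    intro h
    have := h.cardinalMk_le_trdeg.trans htr
    rw [Cardinal.mk_fin] at this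
    exact absurd this (by norm_num)
  rw [algebraicIndependent_iff] at hdep
  push Not at hdep
  obtain ⟨g, hg, hg0⟩ := hdep
  refine ⟨g, hg0, ?_⟩
  rw [← Ideal.Quotient.eq_zero_iff_mem, ← hg]
  have : aeval (fun i => Ideal.Quotient.mk (vanishingIdeal ℂ Z) (![X (Fin.last n), w] i)) =
      (Ideal.Quotient.mkₐ ℂ (vanishingIdeal ℂ Z)).comp (aeval ![X (Fin.last n), w]) := by
    rw [comp_aeval]; rfl
  rw [this]; rfl

/-- Multiplying complex relations on the finitely many dominant components gives one on all of
`V_dom`. Without a rational relation the closure of the image, being defined over `ℚ`, would be the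
whole plane. -/
theorem exists_rational_relation {I : Ideal (MvPolynomial (Fin (n + 1)) ℚ)}
    (hI : dominantPart {p : Fin (n + 1) → ℂ | ∀ i, aeval p (F i) = 0} = zeroLocus ℂ I)
    (hmeet : ∀ C ∈ components {p : Fin (n + 1) → ℂ | ∀ i, aeval p (F i) = 0}, IsDominantT C →
      ∃ x ∈ C, aeval x (jacobianX F) ≠ 0) (w : MvPolynomial (Fin (n + 1)) ℚ) :
    ∃ g : MvPolynomial (Fin 2) ℚ, g ≠ 0 ∧
      aeval ![X (Fin.last n), w] g ∈ vanishingIdeal ℚ (zeroLocus ℂ I) := by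
  set V := {p : Fin (n + 1) → ℂ | ∀ i, aeval p (F i) = 0}
  let S := {C ∈ components V | IsDominantT C}
  have hS : S.Finite := (finite_components (isVariety_setOf_aeval F)).subset fun _ hC => hC.1
  have hrel : ∀ C ∈ S, ∃ g : MvPolynomial (Fin 2) ℂ, g ≠ 0 ∧
      aeval ![X (Fin.last n), map (algebraMap ℚ ℂ) w] g ∈ vanishingIdeal ℂ C := by
    intro C hC
    obtain ⟨x, hx, hJ⟩ := hmeet C hC.1 hC.2
    exact exists_relation_of_jacobianX_ne_zero hC.1 hx hJ _
  choose! g hg0 hg using hrel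
  let G := ∏ C ∈ hS.toFinset, g C
  have hG0 : G ≠ 0 := Finset.prod_ne_zero_iff.2 fun C hC => hg0 C (hS.mem_toFinset.1 hC)
  by_contra! hno
  let s : Fin 2 → MvPolynomial (Fin (n + 1)) ℚ := ![X (Fin.last n), w]
  have hbot : vanishingIdeal ℚ ((fun (x : Fin (n + 1) → ℂ) i => aeval x (s i)) '' zeroLocus ℂ I) =
      ⊥ := by
    refine eq_bot_iff.2 fun f hf => ?_
    by_contra hf0
    refine hno f hf0 fun x hx => ?_
    rw [← AlgHom.comp_apply (aeval x : MvPolynomial (Fin (n + 1)) ℚ →ₐ[ℚ] ℂ), comp_aeval]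
    exact hf _ ⟨x, hx, rfl⟩
  have hcl := zariskiClosure_image_aeval I s
  rw [hbot, zeroLocus_bot, zariskiClosure_eq] at hcl
  refine hG0 (MvPolynomial.funext fun y => ?_)
  have hy : y ∈ zeroLocus ℂ (vanishingIdeal ℂ
      ((fun (x : Fin (n + 1) → ℂ) i => aeval x (s i)) '' zeroLocus ℂ I)) := hcl ▸ trivial
  rw [map_zero, ← aeval_eq_eval]
  refine hy G ?_
  rintro _ ⟨x, hx, rfl⟩
  rw [← hI] at hx
  obtain ⟨C, hC, hxC⟩ := hx
  rw [map_prod]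
  refine Finset.prod_eq_zero (hS.mem_toFinset.2 hC) ?_
  have := hg C hC x hxC
  rw [← AlgHom.comp_apply, comp_aeval] at this
  have e : (fun i => aeval x (s i)) =
      fun i => aeval x (![X (Fin.last n), map (algebraMap ℚ ℂ) w] i) := by
    ext i
    fin_cases i <;> simp [s, aeval_map_algebraMap]
  rw [← e] at this
  exact this

/-- A nonzero `r(T)` vanishes identically on no dominant component, so primality of each component's
ideal lets it be cancelled. -/
theorem saturated_of_isDominantT {V : Set (Fin (n + 1) → ℂ)}
    {f : MvPolynomial (Fin (n + 1)) ℚ} {r : MvPolynomial (Fin 1) ℚ} (hr : r ≠ 0)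
    (h : rename (fun _ => Fin.last n) r * f ∈ vanishingIdeal ℚ (dominantPart V)) :
    f ∈ vanishingIdeal ℚ (dominantPart V) := by
  rintro x ⟨C, hC, hxC⟩
  have hp := isPrime_vanishingIdeal hC.1.1.1
  have hm : map (algebraMap ℚ ℂ) (rename (fun _ => Fin.last n) r * f) ∈ vanishingIdeal ℂ C :=
    (map_mem_vanishingIdeal_iff _).2 fun y hy => h y ⟨C, hC, hy⟩
  rw [map_mul] at hm
  refine (hp.mem_or_mem hm).elim (fun h1 => absurd ?_ hr)
    fun h1 => (map_mem_vanishingIdeal_iff _).1 h1 x hxC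
  have h2 := hC.2
  rw [IsDominantT, zariskiClosure_eq] at h2
  refine map_injective (algebraMap ℚ ℂ) (algebraMap ℚ ℂ).injective ?_
  rw [map_zero]
  refine MvPolynomial.funext fun y => ?_
  have hy : y ∈ zeroLocus ℂ (vanishingIdeal ℂ (projT n '' C)) := h2 ▸ trivial
  rw [map_zero, ← aeval_eq_eval]
  refine hy _ ((map_mem_vanishingIdeal_iff _).2 ?_)
  rintro _ ⟨z, hz, rfl⟩
  have := (map_mem_vanishingIdeal_iff _).1 h1 z hz
  rwa [aeval_rename] at this

end Relations

theorem exists_separating_mvPolynomial {n : ℕ} {S : Set (Fin n → ℂ)} (hS : S.Finite) :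
    ∃ P : MvPolynomial (Fin n) ℚ, P ≠ 0 ∧ ∀ l : Fin n → ℚ, eval l P ≠ 0 →
      Set.InjOn (fun v : Fin n → ℂ => ∑ j, (l j : ℂ) * v j) S := by
  classical
  have h1 : ∀ v : Fin n → ℂ, v ≠ 0 → ∃ P : MvPolynomial (Fin n) ℚ, P ≠ 0 ∧
      ∀ l : Fin n → ℚ, eval l P ≠ 0 → ∑ j, (l j : ℂ) * v j ≠ 0 := by
    intro v hv
    obtain ⟨k, hk⟩ := Function.ne_iff.1 hv
    -- A functional `φ` with `φ (v k) ≠ 0` turns the complex form `∑ lⱼ vⱼ` into a nonzero rational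
    -- linear form in `l`, whose nonvanishing suffices.
    obtain ⟨φ, hφ⟩ := Module.Projective.exists_dual_ne_zero ℚ hk
    refine ⟨∑ j, C (φ (v j)) * X j, fun h => hφ ?_, fun l hl h0 => hl ?_⟩
    · have := congrArg (eval (Pi.single k 1)) h
      simpa [Pi.single_apply] using this
    · have : eval l (∑ j, C (φ (v j)) * X j) = φ (∑ j, (l j : ℂ) * v j) := by
        simp only [map_sum, map_mul, eval_C, eval_X]
        refine Finset.sum_congr rfl fun j _ => ?_
        rw [← Rat.smul_def, map_smul, smul_eq_mul, mul_comm]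
      rw [this, h0, map_zero]
  choose! P hP0 hP using h1
  refine ⟨∏ a ∈ hS.toFinset.offDiag, P (a.1 - a.2), ?_, fun l hl a ha b hb hab => ?_⟩
  · refine Finset.prod_ne_zero_iff.2 fun a ha => hP0 _ ?_
    rw [Finset.mem_offDiag] at ha
    exact sub_ne_zero.2 ha.2.2
  · by_contra hne
    rw [map_prod, Finset.prod_ne_zero_iff] at hl
    refine hP (a - b) (sub_ne_zero.2 hne) l (hl (a, b) ?_) ?_
    · simp [hne, ha, hb]
    · simpa [mul_sub, sub_eq_zero] using hab

theorem isMinimalEquation_of_vanishingIdeal_eq {A : Set (Fin 2 → ℂ)} {M : MvPolynomial (Fin 2) ℚ}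
    (hM : M ≠ 0) (hA : vanishingIdeal ℚ A = Ideal.span {M})
    (hcl : zariskiClosure A = zeroLocus ℂ (vanishingIdeal ℚ A)) :
    IsMinimalEquation M (zariskiClosure A) := by
  rw [hcl, hA]
  refine ⟨rfl, fun M' hM' => ?_⟩
  have hdvd : M ∣ M' := by
    rw [← Ideal.mem_span_singleton, ← hA]
    intro x hx
    have : x ∈ zeroLocus ℂ (Ideal.span {M'}) := by
      rw [hM', ← hA]
      exact zeroLocus_vanishingIdeal_le A hx
    exact this M' (Ideal.mem_span_singleton_self M')
  obtain ⟨N, rfl⟩ := hdvd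
  have hN : N ≠ 0 := by
    rintro rfl
    rw [mul_zero, Ideal.span_singleton_eq_bot.2 rfl, zeroLocus_bot] at hM'
    refine hM (map_injective (algebraMap ℚ ℂ) (algebraMap ℚ ℂ).injective ?_)
    rw [map_zero]
    refine MvPolynomial.funext fun y => ?_
    rw [map_zero, ← aeval_eq_eval, aeval_map_algebraMap]
    have : y ∈ zeroLocus ℂ (Ideal.span {M}) := hM' ▸ trivial
    exact this M (Ideal.mem_span_singleton_self M)
  rw [totalDegree_mul_of_isDomain hM hN]
  exact Nat.le_add_right _ _

/-- Transcendence of `t` embeds `ℚ[T]` in `ℂ`, so specialization preserves both the `Y`-degree and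
separability. -/
theorem encard_zeros_of_transcendental {M : MvPolynomial (Fin 2) ℚ}
    (hM : (polyInY M).IsPrimitive) (hrad : (Ideal.span {polyInY M}).IsRadical) {t : ℂ}
    (ht : Transcendental ℚ t) :
    {y : ℂ | aeval ![t, y] M = 0}.encard = M.degreeOf 1 := by
  classical
  let R := MvPolynomial (Fin 1) ℚ
  let _ : Algebra R ℂ := (aeval fun _ : Fin 1 => t).toRingHom.toAlgebra
  have : IsScalarTower ℚ R ℂ := .of_algebraMap_eq' (Subsingleton.elim _ _)
  have hinj : Function.Injective (algebraMap R ℂ) :=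
    (algebraicIndependent_unique_type_iff (ι := Fin 1) (x := fun _ : Fin 1 => t)).2 ht
  have hX : algebraMap R ℂ (X 0) = t := aeval_X _ _
  set f : Polynomial ℂ := (polyInY M).map (algebraMap R ℂ)
  have hf : f.Separable := separable_map_of_injective hinj hM hrad
  have hset : {y : ℂ | aeval ![t, y] M = 0} = f.roots.toFinset := by
    ext y
    have h := aeval_polyInY y M
    rw [hX] at h
    simp only [Set.mem_ofPred_eq, Finset.mem_coe, Multiset.mem_toFinset,
      Polynomial.mem_roots hf.ne_zero, Polynomial.IsRoot.def]
    rw [← h, Polynomial.eval_map_algebraMap]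
  rw [hset, Set.encard_coe_eq_coe_finsetCard,
    Multiset.toFinset_card_of_nodup (Polynomial.nodup_roots hf),
    ← (IsAlgClosed.splits f).natDegree_eq_card_roots,
    Polynomial.natDegree_map_eq_of_injective hinj, natDegree_polyInY]

/-- Algebraic numbers are countable, and the complement of a countable set is dense in `ℂ`. -/
theorem exists_transcendental_of_eventually {P Q : ℂ → Prop} {t₀ : ℂ} (hP : ∀ᶠ t in 𝓝 t₀, P t)
    (hQ : ∀ᶠ t in Filter.cofinite, Q t) : ∃ t, Transcendental ℚ t ∧ P t ∧ Q t := by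
  have hc : ({t : ℂ | IsAlgebraic ℚ t} ∪ {t | ¬ Q t}).Countable :=
    (Algebraic.countable ℚ ℂ).union (Set.Finite.countable hQ)
  obtain ⟨t, ht, htP⟩ := (hc.dense_compl ℝ).inter_nhds_nonempty hP
  rw [Set.mem_compl_iff, Set.mem_union, not_or] at ht
  exact ⟨t, ht.1, htP, not_not.1 ht.2⟩

/-- The ideal of the rational relations between `T` and `w` on `V_dom` is generated by a
polynomial that is primitive and squarefree as a polynomial in `Y`. -/
theorem exists_generator_vanishingIdeal {n : ℕ} {V : Set (Fin (n + 1) → ℂ)}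
    {w : MvPolynomial (Fin (n + 1)) ℚ} {A : Set (Fin 2 → ℂ)}
    (hA : A = (fun x i => aeval x ((![X (Fin.last n), w] : Fin 2 → _) i)) '' dominantPart V)
    (hne : ∃ g : MvPolynomial (Fin 2) ℚ, g ≠ 0 ∧
      aeval ![X (Fin.last n), w] g ∈ vanishingIdeal ℚ (dominantPart V)) :
    ∃ M : MvPolynomial (Fin 2) ℚ, (polyInY M).IsPrimitive ∧
      (Ideal.span {polyInY M}).IsRadical ∧ vanishingIdeal ℚ A = Ideal.span {M} := by
  have hmem : ∀ g : MvPolynomial (Fin 2) ℚ, g ∈ vanishingIdeal ℚ A ↔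
      aeval ![X (Fin.last n), w] g ∈ vanishingIdeal ℚ (dominantPart V) := by
    intro g
    rw [hA, mem_vanishingIdeal_iff, mem_vanishingIdeal_iff, Set.forall_mem_image]
    refine forall₂_congr fun x _ => ?_
    rw [← AlgHom.comp_apply (aeval x : MvPolynomial (Fin (n + 1)) ℚ →ₐ[ℚ] ℂ), comp_aeval]
  let J : Ideal (Polynomial (MvPolynomial (Fin 1) ℚ)) :=
    (vanishingIdeal ℚ A).comap polyInY.symm.toRingEquiv.toRingHom
  have hJ : ∀ f, f ∈ J ↔ polyInY.symm f ∈ vanishingIdeal ℚ A := fun _ => Iff.rfl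
  have hJ0 : J ≠ ⊥ := by
    obtain ⟨g, hg0, hg⟩ := hne
    intro h
    have : polyInY g ∈ J := by rw [hJ, AlgEquiv.symm_apply_apply, hmem]; exact hg
    rw [h, Ideal.mem_bot] at this
    exact hg0 (by simpa using this)
  obtain ⟨N, hN, hJN⟩ := exists_isPrimitive_span_eq hJ0 (by
    intro r g hr hg
    rw [hJ, map_mul, polyInY_symm_C, hmem, map_mul] at hg
    rw [hJ, hmem]
    refine saturated_of_isDominantT hr ?_
    have h2 : (aeval ![X (Fin.last n), w] : MvPolynomial (Fin 2) ℚ →ₐ[ℚ] _).comp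
        (rename fun _ : Fin 1 => 0) = rename fun _ => Fin.last n := by
      ext1 i
      simp
    rwa [← h2])
  have hsymm : polyInY (polyInY.symm N) = N := polyInY.apply_symm_apply N
  refine ⟨polyInY.symm N, by rwa [hsymm], ?_, ?_⟩
  · rw [hsymm, ← hJN]
    rintro f ⟨k, hk⟩
    rw [hJ, map_pow] at hk
    rw [hJ]
    intro x hx
    have := hk x hx
    rw [map_pow] at this
    exact eq_zero_of_pow_eq_zero this
  · ext g
    have h1 : g ∈ vanishingIdeal ℚ A ↔ polyInY g ∈ J := by
      rw [hJ, AlgEquiv.symm_apply_apply]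
    rw [h1, hJN, Ideal.mem_span_singleton, Ideal.mem_span_singleton, ← map_dvd_iff polyInY, hsymm]

theorem hasProjectionDegree_dominantPart {n D : ℕ} {F : Fin n → MvPolynomial (Fin (n + 1)) ℚ}
    {V : Set (Fin (n + 1) → ℂ)} (hV : V = {p | ∀ i, aeval p (F i) = 0})
    (hgen : ∀ᶠ t : ℂ in Filter.cofinite, (fibreT V t).encard ≤ D) {t₀ : ℂ}
    (hdeg : (fibreT V t₀).encard = D)
    (hJ : ∀ p ∈ fibreT V t₀, aeval p (jacobianX F) ≠ 0)
    (hI : dominantPart V = zeroLocus ℂ (vanishingIdeal ℚ (dominantPart V)))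
    (hmeet : ∀ C ∈ components V, IsDominantT C → ∃ x ∈ C, aeval x (jacobianX F) ≠ 0) :
    HasProjectionDegree (dominantPart V) D := by
  have hfin : (fibreT V t₀).Finite := Set.finite_of_encard_eq_coe hdeg
  obtain ⟨P, hP0, hP⟩ := exists_separating_mvPolynomial
    (hfin.image fun (p : Fin (n + 1) → ℂ) (j : Fin n) => p j.castSucc)
  refine ⟨P, hP0, fun l hl => ?_⟩
  let w : MvPolynomial (Fin (n + 1)) ℚ := ∑ j : Fin n, C (l j) * X j.castSucc
  let u : (Fin (n + 1) → ℂ) → ℂ := fun p => aeval p w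
  have hu : ∀ p, u p = ∑ j : Fin n, (l j : ℂ) * p j.castSucc := fun p => by simp [u, w]
  have huinj : Set.InjOn u (fibreT V t₀) := by
    intro p hp q hq hpq
    rw [hu, hu] at hpq
    have h := hP l hl ⟨p, hp, rfl⟩ ⟨q, hq, rfl⟩ hpq
    ext j
    induction j using Fin.lastCases with
    | last => rw [hp.2, hq.2]
    | cast j => exact congrFun h j
  have hproj : ∀ p, projU l p = ![p (Fin.last n), u p] := fun p => by rw [hu]; rfl
  have hproj' : projU l = fun x i => aeval x ((![X (Fin.last n), w] : Fin 2 → _) i) := by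
    ext p i
    rw [hproj]
    fin_cases i <;> simp [u]
  have hrel : ∀ f, ∃ g : MvPolynomial (Fin 2) ℚ, g ≠ 0 ∧
      aeval ![X (Fin.last n), f] g ∈ vanishingIdeal ℚ (dominantPart V) := by
    intro f
    rw [hI]
    exact exists_rational_relation (F := F) (by rw [← hV]; exact hI) (by rwa [← hV]) f
  obtain ⟨M, hM, hrad, hspan⟩ := exists_generator_vanishingIdeal
    (A := projU l '' dominantPart V) (by rw [hproj']) (hrel w)
  have hcl : zariskiClosure (projU l '' dominantPart V) =
      zeroLocus ℂ (vanishingIdeal ℚ (projU l '' dominantPart V)) := by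
    rw [hI, hproj']
    exact zariskiClosure_image_aeval _ _
  have hM0 : M ≠ 0 := by
    rintro rfl
    exact hM.ne_zero (map_zero _)
  have hMz : ∀ p ∈ dominantPart V, aeval ![p (Fin.last n), u p] M = 0 := by
    intro p hp
    have : M ∈ vanishingIdeal ℚ (projU l '' dominantPart V) :=
      hspan ▸ Ideal.mem_span_singleton_self M
    rw [← hproj]
    exact this _ ⟨p, hp, rfl⟩
  refine ⟨M, isMinimalEquation_of_vanishingIdeal_eq hM0 hspan hcl, ?_⟩
  have hcont : Continuous u := continuous_aeval_mvPolynomial w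
  obtain ⟨O, hO, hOd⟩ := (hfin.image u).t2_separation
  -- The neighbourhoods keep the values of `u` apart and `J` nonzero; the latter places the deformed
  -- points in `V_dom`.
  have hnear := eventually_exists_mem_of_fibreT hV hfin hJ
    (U := fun p => u ⁻¹' O (u p) ∩ {q | aeval q (jacobianX F) ≠ 0}) fun p hp =>
      Filter.inter_mem (((hO (u p)).2.preimage hcont).mem_nhds (hO (u p)).1)
        ((isOpen_ne_fun (continuous_aeval_mvPolynomial _) continuous_const).mem_nhds (hJ p hp))
  obtain ⟨t, ht, h1, h2⟩ := exists_transcendental_of_eventually hnear hgen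
  choose! q hqU hqV using h1
  have hinj : Set.InjOn (u ∘ q) (fibreT V t₀) := by
    intro a ha b hb hab
    by_contra hne
    have hne' : u a ≠ u b := fun h => hne (huinj ha hb h)
    have hab' : u (q a) = u (q b) := hab
    refine Set.disjoint_left.1 (hOd ⟨a, ha, rfl⟩ ⟨b, hb, rfl⟩ hne') (hqU a ha).1 ?_
    rw [hab']
    exact (hqU b hb).1
  have hle : (D : ℕ∞) ≤ {y : ℂ | aeval ![t, y] M = 0}.encard := by
    rw [← hdeg, ← hinj.encard_image]
    refine Set.encard_le_encard ?_
    rintro _ ⟨p, hp, rfl⟩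
    have hqd : q p ∈ dominantPart V := by
      have h := (hqV p hp).1
      rw [hV] at h ⊢
      exact mem_dominantPart_of_jacobianX_ne_zero h (hqU p hp).2
    have := hMz (q p) hqd
    rwa [(hqV p hp).2] at this
  -- Each root is the `u`-value of a point of `V_dom` over `t`, since all rational relations between
  -- `T` and `u` are multiples of `M`.
  have hge : {y : ℂ | aeval ![t, y] M = 0}.encard ≤ D := by
    refine le_trans ((Set.encard_le_encard ?_).trans (Set.encard_image_le u (fibreT V t))) h2
    intro y hy
    obtain ⟨x, hx, hxt, hxy⟩ := exists_mem_zeroLocus_of_transcendental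
      (I := vanishingIdeal ℚ (dominantPart V)) (i₀ := Fin.last n) (w := w) hrel ht (y := y)
      fun g hg => by
        have hg' : g ∈ vanishingIdeal ℚ (projU l '' dominantPart V) := by
          rintro _ ⟨x, hx, rfl⟩
          have := hg x hx
          rwa [← AlgHom.comp_apply (aeval x : MvPolynomial (Fin (n + 1)) ℚ →ₐ[ℚ] ℂ), comp_aeval,
            ← congrFun hproj' x] at this
        rw [hspan, Ideal.mem_span_singleton] at hg'
        obtain ⟨N, rfl⟩ := hg'
        rw [map_mul, show aeval ![t, y] M = 0 from hy, zero_mul]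
    rw [← hI] at hx
    obtain ⟨C, hC, hxC⟩ := hx
    exact ⟨x, ⟨hC.1.1.2 hxC, hxt⟩, hxy⟩
  rw [encard_zeros_of_transcendental hM hrad ht] at hle hge
  exact_mod_cast le_antisymm hge hle

/-! ### The main theorem -/

theorem mainTheorem8 (n D : ℕ) (F : Fin n → MvPolynomial (Fin (n + 1)) ℚ)
    (I : Ideal (MvPolynomial (Fin (n + 1)) ℚ)) (hI : I = Ideal.span (Set.range F))
    (V : Set (Fin (n + 1) → ℂ)) (hV : V = {p | ∀ i, aeval p (F i) = 0})
    -- the fibres over all but finitely many `t` have at most `D` points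
    (hgen : ∀ᶠ t : ℂ in Filter.cofinite, (fibreT V t).encard ≤ D)
    (t₀ : ℂ)
    -- the fibre over `t₀` is a zero-dimensional variety of degree `D`
    (hdim : varietyDim (fibreT V t₀) = 0)
    (hdeg : (fibreT V t₀).encard = D)
    (hJ : ∀ p ∈ fibreT V t₀, aeval p (jacobianX F) ≠ 0) :
    ((dominantPart V).Nonempty ∧ IsEquidimensional (dominantPart V) 1) ∧
    dominantPart V = ⋃₀ {C ∈ components V | (C ∩ fibreT V t₀).Nonempty} ∧
    dominantPart V = zeroLocus ℂ (saturation I (jacobianX F)) ∧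
    (IsDominantT (dominantPart V) ∧ HasProjectionDegree (dominantPart V) D) := by
  have hVv : IsVariety V := hV ▸ isVariety_setOf_aeval F
  have hdom : ∀ C ∈ components V, IsDominantT C ↔ (C ∩ fibreT V t₀).Nonempty := by
    refine fun C hC => ⟨exists_mem_fibreT_of_isDominantT hV hgen hdeg hJ hC, ?_⟩
    rintro ⟨x, hxC, hx⟩
    exact isDominantT_of_jacobianX_ne_zero (hV ▸ hC) hxC (hJ x hx)
  have hmeet : ∀ C ∈ components V, IsDominantT C → ∃ x ∈ C, aeval x (jacobianX F) ≠ 0 := by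
    intro C hC hCd
    obtain ⟨x, hxC, hx⟩ := (hdom C hC).1 hCd
    exact ⟨x, hxC, hJ x hx⟩
  have hsat : dominantPart V = zeroLocus ℂ (saturation I (jacobianX F)) := by
    subst hI
    refine Set.Subset.antisymm (Set.sUnion_subset fun C hC => ?_)
      (hV ▸ zeroLocus_saturation_subset_dominantPart F)
    obtain ⟨x, hxC, hx⟩ := hmeet C hC.1 hC.2
    exact subset_zeroLocus_saturation (hV ▸ hC.1) hxC hx
  -- Dimension `0` excludes the empty fibre, whose dimension is `⊥`; this matters when `D = 0`.
  obtain ⟨p, hp⟩ : (fibreT V t₀).Nonempty := by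
    rw [Set.nonempty_iff_ne_empty]
    intro h
    rw [h, varietyDim, vanishingIdeal_empty, ringKrullDim_eq_bot_of_subsingleton] at hdim
    exact absurd hdim (by simp)
  obtain ⟨C, hC, hpC⟩ := exists_mem_components hp.1
  have hCd : IsDominantT C := (hdom C hC).2 ⟨p, hpC, hp⟩
  refine ⟨⟨⟨p, C, ⟨hC, hCd⟩, hpC⟩, isVariety_dominantPart hVv, fun Z hZ => ?_⟩, ?_, hsat, ?_, ?_⟩
  · have hZ' := mem_of_mem_components_sUnion hVv (fun _ h => h.1) hZ
    obtain ⟨x, hxZ, hx⟩ := hmeet Z hZ'.1 hZ'.2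
    exact varietyDim_eq_one_of_jacobianX_ne_zero (hV ▸ hZ'.1) hxZ hx
  · refine congrArg Set.sUnion (Set.ext fun Z => and_congr_right fun hZ => hdom Z hZ)
  · have hCmem : C ∈ {C ∈ components V | IsDominantT C} := ⟨hC, hCd⟩
    rw [IsDominantT, Set.eq_univ_iff_forall] at hCd ⊢
    intro y
    have hsub : C ⊆ dominantPart V := Set.subset_sUnion_of_mem hCmem
    exact @closure_mono _ (zariskiTop (Fin 1)) _ _ (Set.image_mono (f := projT n) hsub) y (hCd y)
  · refine hasProjectionDegree_dominantPart hV hgen hdeg hJ ?_ hmeet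
    -- `V_dom` is cut out by the saturation, an ideal over `ℚ`, so its rational equations suffice to
    -- define it.
    refine Set.Subset.antisymm (zeroLocus_vanishingIdeal_le _) ?_
    nth_rw 2 [hsat]
    rw [hsat]
    exact zeroLocus_anti_mono (le_vanishingIdeal_zeroLocus _)
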